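/- Let $\Bbbk$ be an algebraically closed field of characteristic zero and let $I$ be an infinite set with $|I|<|\Bbbk|$. Let $B=\Bbbk[x_i : i\in I]$, and let $A\subset \mathrm{End}_{\Bbbk}(B)$ be the infinite Weyl algebra, i.e. the subalgebra generated by the multiplication operators $X_i=x_i\cdot$ and the partial derivatives $Y_i=\partial/\partial x_i$, $i\in I$. Put $t_i=X_iY_i$ and let $A_0\subset A$ be the subalgebra generated by all $t_i$. An element $x$ of a (left) $A$-module $M$ is called a weight element if $\mathfrak{m}\cdot x=0$ for some maximal ideal $\mathfrak{m}$ of $A_0$; $M$ is called a weight module if it has a $\Bbbk$-basis consisting of weight elements. For $\mathbf{q}\in\Bbbk^I$ put $M_{\mathbf{q}}=\{x\in M : t_i x=q_i x \text{ for all } i\in I\}$ and $\mathrm{supp}(M)=\{\mathbf{q}\in\Bbbk^I : M_{\mathbf{q}}\neq 0\}$. Let $\mathbb{Z}_f^I\subset \Bbbk^I$ be the group of integral vectors with finitely many nonzero entries. For $\mathbf{p}\in\Bbbk^I$ let $\mathfrak{W}_{\mathbf{p}}$ be the full subcategory of the category of all $A$-modules whose objects are the weight modules $M$ with $\mathrm{supp}(M)\subset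 \mathbf{p}+\mathbb{Z}_f^I$, and let $J_{\mathbf{p}}=\{i\in I : p_i\in\mathbb{Z}\}$. For a nonempty set $E$ let $Q_E$ be the quiver whose vertices are the finite subsets of $E$, with exactly one arrow from $U$ to $W$ if the symmetric difference $U\triangle W$ is a singleton, and no arrow otherwise. Let $C_E$ be the quotient of the $\Bbbk$-linear path category of $Q_E$ by the following relations: $\beta\alpha=0$ for all arrows $\alpha:U\to W$ and $\beta:W\to U$; and $\beta\alpha=\beta'\alpha'$ whenever $U,W,U',W'$ are pairwise different and $\alpha:U\to W$, $\beta:W\to W'$, $\alpha':U\to U'$, $\beta':U'\to W'$ are arrows. A $C_E$-module is a $\Bbbk$-linear functor from $C_E$ to $\Bbbk$-vector spaces; morphisms of modules are natural transformations. Then for every $\mathbf{p}\in\Bbbk^I$: (a) if $J_{\mathbf{p}}\neq\varnothing$, the category $\mathfrak{W}_{\mathbf{p}}$ is equivalent, by a $\Bbbk$-linear equivalence, to the category of $C_{J_{\mathbf{p}}}$-modules; (b) if $J_{\mathbf{p}}=\varnothing$, then $\mathfrak{W}_{\mathbf{p}}$ is semisimple (every module in it is a direct sum of simple $A$-modules),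 and it is equivalent, by a $\Bbbk$-linear equivalence, to the category of $\Bbbk$-vector spaces. -/

import Mathlib

open CategoryTheory

universe u

/-! ### The infinite dimensional Weyl algebra and its weight modules -/

namespace Weyl

section Algebra

variable (k I : Type u) [Field k]

/-- The polynomial ring `B` in the variables `x i`, `i : I`. -/
abbrev Poly : Type u := MvPolynomial I k

/-- Multiplication by `x i`, as a linear operator on `B`. -/
noncomputable def mulX (i : I) : Module.End k (Poly k I) :=
  LinearMap.mulLeft k (MvPolynomial.X i : Poly k I)

/-- The partial derivative with respect to `x i`, as a linear operator on `B`. -/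
noncomputable def partialX (i : I) : Module.End k (Poly k I) :=
  (MvPolynomial.pderiv i : Derivation k (Poly k I) (Poly k I)).toLinearMap

/-- The Weyl algebra `A`: the subalgebra of `End_k(B)` generated by all multiplications by
variables and all partial derivatives. -/
noncomputable def weylSubalgebra : Subalgebra k (Module.End k (Poly k I)) :=
  Algebra.adjoin k (Set.range (mulX k I) ∪ Set.range (partialX k I))

/-- The Weyl algebra `A` as a type. -/
abbrev WeylAlgebra : Type u := weylSubalgebra k I

variable {I}

/-- The generator `X i` of the Weyl algebra. -/
noncomputable def genX (i : I) : WeylAlgebra k I :=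
  ⟨mulX k I i, Algebra.subset_adjoin (Or.inl ⟨i, rfl⟩)⟩

/-- The generator `Y i` of the Weyl algebra. -/
noncomputable def genY (i : I) : WeylAlgebra k I :=
  ⟨partialX k I i, Algebra.subset_adjoin (Or.inr ⟨i, rfl⟩)⟩

/-- The element `t i = X i * Y i`. -/
noncomputable def genT (i : I) : WeylAlgebra k I := genX k i * genY k i


variable (I)

/-- The subalgebra `A₀` of `A` generated by all `t i`. -/
noncomputable def cartan : Subalgebra k (WeylAlgebra k I) :=
  Algebra.adjoin k (Set.range (genT k (I := I)))

end Algebra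

section Modules

variable {k I : Type u} [Field k]

/-- An element of an `A`-module is a weight element if it is annihilated by some maximal ideal of
the algebra `A₀`. -/
def IsWeightElement {M : Type u} [AddCommGroup M] [Module (WeylAlgebra k I) M] (x : M) : Prop :=
  ∃ m : Ideal (cartan k I), m.IsMaximal ∧ ∀ a ∈ m, (a : WeylAlgebra k I) • x = 0

open scoped ModuleCat in
/-- An `A`-module is a weight module if it has a `k`-basis consisting of weight elements. -/
def IsWeightModule (M : ModuleCat.{u} (WeylAlgebra k I)) : Prop :=
  ∃ s : Set M, (∀ x ∈ s, IsWeightElement (k := k) (I := I) x) ∧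
    LinearIndepOn k id s ∧ Submodule.span k s = ⊤

open scoped ModuleCat in
/-- The weight space `M_p` of an `A`-module, `p ∈ k^I`. -/
def weightSpace (M : ModuleCat.{u} (WeylAlgebra k I)) (p : I → k) : Set M :=
  {x | ∀ i, genT k i • x = p i • x}

/-- The support of an `A`-module: all `p` with `M_p ≠ 0`. -/
def support (M : ModuleCat.{u} (WeylAlgebra k I)) : Set (I → k) :=
  {p | ∃ x ∈ weightSpace M p, x ≠ 0}

/-- The coset `p + ℤ_f^I`, where `ℤ_f^I` is the group of finitely supported integral vectors. -/
def latticeCoset (p : I → k) : Set (I → k) :=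
  {q | ∃ v : I →₀ ℤ, ∀ i, q i = p i + (v i : k)}

/-- The property defining the block of `p`: weight modules with support in `p + ℤ_f^I`. -/
def blockProperty (p : I → k) : ObjectProperty (ModuleCat.{u} (WeylAlgebra k I)) :=
  fun M => IsWeightModule M ∧ support M ⊆ latticeCoset p

/-- The block of `p`, a full subcategory of the category of all `A`-modules. -/
abbrev Block (p : I → k) := (blockProperty p).FullSubcategory

/-- The set `J_p` of all `i` such that `p i` is an integer. -/
def integralSet (p : I → k) : Set I := {i | ∃ n : ℤ, p i = (n : k)}

end Modules

end Weyl

/-! ### The path category of the quiver of finite subsets -/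

namespace SubsetQuiver

/-- The vertices of the quiver `Q_E`: the finite subsets of `E`. -/
structure Vertex (E : Type u) : Type u where
  /-- the finite subset -/
  carrier : Finset E

/-- There is exactly one arrow from `U` to `W` if the symmetric difference of `U` and `W` is a
singleton, and none otherwise. -/
instance (E : Type u) : Quiver.{0} (Vertex E) where
  Hom U W := PLift (∃ e : E, symmDiff (U.carrier : Set E) (W.carrier : Set E) = {e})

variable (k E : Type u) [Field k]

/-- The free `k`-linear category on the path category of `Q_E`: morphisms are formal `k`-linear
combinations of paths. -/
abbrev FreePath : Type u := Free k (Paths (Vertex E))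

variable {E}

/-- A vertex, as an object of the `k`-linear path category. -/
noncomputable def vertex (U : Vertex E) : FreePath k E :=
  (Free.embedding k (Paths (Vertex E))).obj ((Paths.of (Vertex E)).obj U)

/-- An arrow, as a morphism of the `k`-linear path category. -/
noncomputable def arrow {U W : Vertex E} (a : U ⟶ W) : vertex k U ⟶ vertex k W :=
  (Free.embedding k (Paths (Vertex E))).map ((Paths.of (Vertex E)).map a)

/-- The `k`-linear congruence on the `k`-linear path category generated by the relations of `Q_E`:
2-cycles vanish and squares with different vertices commute. -/
inductive Rel : HomRel (FreePath k E)
  | cycle {U W : Vertex E} (a : U ⟶ W) (b : W ⟶ U) : Rel (arrow k a ≫ arrow k b) 0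
  | square {U W U' W' : Vertex E} (a : U ⟶ W) (b : W ⟶ W') (a' : U ⟶ U') (b' : U' ⟶ W')
      (h : [U, W, U', W'].Nodup) : Rel (arrow k a ≫ arrow k b) (arrow k a' ≫ arrow k b')
  | refl {X Y : FreePath k E} (f : X ⟶ Y) : Rel f f
  | symm {X Y : FreePath k E} {f g : X ⟶ Y} : Rel f g → Rel g f
  | trans {X Y : FreePath k E} {f g h : X ⟶ Y} : Rel f g → Rel g h → Rel f h
  | add {X Y : FreePath k E} {f f' g g' : X ⟶ Y} : Rel f f' → Rel g g' → Rel (f + g) (f' + g')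
  | smul {X Y : FreePath k E} (c : k) {f g : X ⟶ Y} : Rel f g → Rel (c • f) (c • g)
  | comp_left {X Y Z : FreePath k E} (f : X ⟶ Y) {g g' : Y ⟶ Z} : Rel g g' → Rel (f ≫ g) (f ≫ g')
  | comp_right {X Y Z : FreePath k E} {f f' : X ⟶ Y} (g : Y ⟶ Z) :
      Rel f f' → Rel (f ≫ g) (f' ≫ g)

instance : Congruence (Rel k (E := E)) where
  comp_left f _ _ h := Rel.comp_left f h
  comp_right g h := Rel.comp_right g h
  equivalence := ⟨Rel.refl, Rel.symm, Rel.trans⟩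

variable (E)

/-- The category `C_E`: the `k`-linear path category of `Q_E` modulo the relations. -/
abbrev PathCat : Type u := Quotient (Rel k (E := E))

noncomputable instance : Preadditive (PathCat k E) :=
  Quotient.preadditive _ fun _ _ _ _ _ _ h h' => Rel.add h h'

instance : (Quotient.functor (Rel k (E := E))).Additive :=
  Quotient.functor_additive _ fun _ _ _ _ _ _ h h' => Rel.add h h'

noncomputable instance : Linear k (PathCat k E) :=
  Quotient.linear k _ fun c _ _ _ _ h => Rel.smul c h

end SubsetQuiver

/-- The property of being a `k`-linear functor to `k`-vector spaces. -/
def linearFunctorProperty (k : Type u) [Field k] (C : Type u) [Category.{u} C] [Preadditive C]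
    [Linear k C] : ObjectProperty (C ⥤ ModuleCat.{u} k) :=
  fun F => F.Additive ∧ F.Linear k

/-- The category of modules over a `k`-linear category `C`: `k`-linear functors from `C` to
`k`-vector spaces, with natural transformations as morphisms. -/
abbrev LinearModuleCat (k : Type u) [Field k] (C : Type u) [Category.{u} C] [Preadditive C]
    [Linear k C] := (linearFunctorProperty k C).FullSubcategory

/-!
A module in the block of `p` is the direct sum of its weight spaces `M_{p+v}`, where `v` runs
through the finitely supported integral vectors. The generators `X i` and `Y i` move the weight by
`±e_i`, and `X i * Y i` is the scalar `q i` on the weight space of `q`. Hence `X i` and `Y i` are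
isomorphisms between `M_{q-e_i}` and `M_q`, mutually inverse up to a nonzero scalar, unless `q i = 0`;
in the latter case both composites are zero. So the walls between `-1` and `0` in the directions
`i ∈ J_p` cut the lattice into chambers, which correspond to the finite subsets of `J_p`
(`Weyl.chamber`), and inside a chamber all weight spaces are identified. Crossing a wall is an arrow
of the quiver of `J_p`, the squares commute because generators with different indices commute, and
crossing a wall back and forth is zero: these are the relations of `C_J`.

To make this precise, the category `C_E` is first described by shortest paths: two shortest paths
agree by the square relations (`SubsetQuiver.pathHom_eq_of_geodesic`) and other paths vanish
(`SubsetQuiver.pathHom_eq_zero`). Therefore a `C_E`-module is a `SubsetQuiver.CubeSystem`: a family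
of vector spaces `V U` with maps `φ U W` which compose when no direction occurs twice, and compose to
zero otherwise. A system defines a weight module, `Weyl.Model`, with one copy of `V U` at each weight
in the chamber `U`. That the operators `X i` and `Y i` on it define an action of the Weyl algebra
needs a presentation of that algebra (`Weyl.exists_representation`), which follows from the fact that
differential operators in normal form act faithfully on polynomials in characteristic zero.

The resulting functor `Weyl.modelFunctor` is fully faithful, since homomorphisms preserve weights and
commute with the action of shortest paths (`Weyl.Model.exists_map_eq`). It is essentially surjective
(`Weyl.exists_model_equiv`): after rescaling the `Y i` to make them inverse to the `X i` away from the
walls, there is a parallel transport between any two weight spaces (`Weyl.exists_transport_comp`),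
and the weight spaces at chosen weights of the chambers, with the transports between them, form the
required system. The assumption `|I| < |k|` enters through the Nullstellensatz for `A₀`
(`Weyl.IsWeightElement.exists_eigenvalues`): its residue fields are `k`, so that weight elements
are simultaneous eigenvectors of the `t i`.

If `J_p` is empty, then `C_J` has a single object with endomorphism ring `k`, and evaluation at this
object is an equivalence with the category of vector spaces. Monomorphisms of vector spaces split,
hence so do inclusions of submodules in the block, and all its modules are semisimple.
-/

/-! ### The Weyl algebra is presented by the Weyl relations -/

namespace Weyl

section Presentation

variable {k I : Type u} [Field k]

/-- Polynomials can be evaluated at pairwise commuting elements of a noncommutative algebra. -/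
theorem exists_algHom_of_commute {R : Type*} [Ring R] [Algebra k R] (x : I → R)
    (h : ∀ i j, x i * x j = x j * x i) :
    ∃ φ : MvPolynomial I k →ₐ[k] R, ∀ i, φ (MvPolynomial.X i) = x i := by
  have hc : ∀ a ∈ Set.range x, ∀ b ∈ Set.range x, a * b = b * a := by
    rintro _ ⟨i, rfl⟩ _ ⟨j, rfl⟩
    exact h i j
  have := Algebra.isMulCommutative_adjoin k hc
  open scoped IsMulCommutative in
  exact ⟨(Algebra.adjoin k (Set.range x)).val.comp (MvPolynomial.aeval
      fun i => ⟨x i, Algebra.subset_adjoin ⟨i, rfl⟩⟩), fun i => by simp⟩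

/-- The relations satisfied by the generators of the Weyl algebra, for families of elements of an
arbitrary algebra. -/
structure WeylRelations {R : Type*} [Ring R] (x y : I → R) : Prop where
  xx : ∀ i j, x i * x j = x j * x i
  yy : ∀ i j, y i * y j = y j * y i
  yx_ne : ∀ i j, i ≠ j → y i * x j = x j * y i
  yx_self : ∀ i, y i * x i = x i * y i + 1

theorem mulX_apply (i : I) (f : Poly k I) : mulX k I i f = MvPolynomial.X i * f := rfl

theorem partialX_apply (i : I) (f : Poly k I) : partialX k I i f = MvPolynomial.pderiv i f := rfl

theorem weylRelations_operators : WeylRelations (mulX k I) (partialX k I) where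
  xx i j := by
    refine LinearMap.ext fun f => ?_
    simp only [Module.End.mul_apply, mulX_apply]
    ring
  yy i j := by
    let D : I → Derivation k (Poly k I) (Poly k I) := MvPolynomial.pderiv
    have h : ⁅D i, D j⁆ = 0 := by
      classical
      refine MvPolynomial.derivation_ext fun l => ?_
      simp [D, Derivation.commutator_apply, MvPolynomial.pderiv_X, Pi.single_apply, apply_ite]
    refine LinearMap.ext fun f => ?_
    have h1 := Derivation.commutator_apply (D1 := D i) (D2 := D j) f
    rw [h] at h1
    exact (sub_eq_zero.1 h1.symm)
  yx_ne i j h := by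
    refine LinearMap.ext fun f => ?_
    simp only [Module.End.mul_apply, mulX_apply, partialX_apply]
    rw [Derivation.leibniz, MvPolynomial.pderiv_X_of_ne h.symm]
    simp
  yx_self i := by
    refine LinearMap.ext fun f => ?_
    simp only [Module.End.mul_apply, mulX_apply, partialX_apply, LinearMap.add_apply,
      Module.End.one_apply]
    rw [Derivation.leibniz, MvPolynomial.pderiv_X_self]
    simp

theorem weylRelations_gen : WeylRelations (genX k (I := I)) (genY k) where
  xx i j := Subtype.ext (weylRelations_operators.xx i j)
  yy i j := Subtype.ext (weylRelations_operators.yy i j)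
  yx_ne i j h := Subtype.ext (weylRelations_operators.yx_ne i j h)
  yx_self i := Subtype.ext (weylRelations_operators.yx_self i)

/-- The differential operator `∂^b` sends a monomial `x^s` to a multiple of `x^(s-b)`, which is
nonzero exactly when `b ≤ s`. -/
theorem exists_partial_monomial [CharZero k] (η : Poly k I →ₐ[k] Module.End k (Poly k I))
    (hη : ∀ i, η (MvPolynomial.X i) = partialX k I i) (b s : I →₀ ℕ) :
    ∃ c : k, (c ≠ 0 ↔ b ≤ s) ∧
      η (MvPolynomial.monomial b 1) (MvPolynomial.monomial s 1) =
        MvPolynomial.monomial (s - b) c := by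
  classical
  induction hn : b.degree generalizing b s with
  | zero =>
    rw [Finsupp.degree_eq_zero_iff] at hn
    subst hn
    refine ⟨1, by simp, ?_⟩
    have : η (MvPolynomial.monomial 0 1) = 1 := map_one η
    rw [this]
    simp
  | succ n ih =>
    have hb : b ≠ 0 := by
      rintro rfl
      simp at hn
    obtain ⟨i, hi⟩ := Finsupp.support_nonempty_iff.2 hb
    have hle : Finsupp.single i 1 ≤ b := by
      rw [Finsupp.single_le_iff]
      exact Nat.one_le_iff_ne_zero.2 (Finsupp.mem_support_iff.1 hi)
    obtain ⟨d, rfl⟩ := exists_add_of_le hle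
    have hd : d.degree = n := by
      rw [map_add, Finsupp.degree_single] at hn
      omega
    obtain ⟨c, hc, hcs⟩ := ih d s hd
    refine ⟨c * ((s - d) i : ℕ), ?_, ?_⟩
    · rw [mul_ne_zero_iff, hc, Nat.cast_ne_zero, Finsupp.tsub_apply]
      constructor
      · rintro ⟨h1, h2⟩ j
        have := h1 j
        rw [Finsupp.add_apply]
        by_cases hj : i = j
        · subst hj
          rw [Finsupp.single_eq_same]
          omega
        · rw [Finsupp.single_eq_of_ne' hj]
          omega
      · intro h
        refine ⟨fun j => le_trans (by simp) (h j), ?_⟩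
        have := h i
        rw [Finsupp.add_apply, Finsupp.single_eq_same] at this
        omega
    · have hm : (MvPolynomial.monomial (Finsupp.single i 1 + d) (1 : k)) =
          MvPolynomial.X i * MvPolynomial.monomial d 1 := by
        rw [MvPolynomial.X, MvPolynomial.monomial_mul, one_mul]
      rw [hm, map_mul, hη, Module.End.mul_apply, hcs, partialX_apply,
        MvPolynomial.pderiv_monomial, add_comm, tsub_tsub]

/-- In an algebra generated by families satisfying the Weyl relations, every element is a sum of
products of a polynomial in the `x i` and a monomial in the `y i`. Such sums are stable under left
multiplication by the generators, since `y i * g = g * y i + ∂g/∂x i`. -/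
theorem exists_normal_form {R : Type*} [Ring R] [Algebra k R] {x y : I → R}
    (h : WeylRelations x y) (ξ η : Poly k I →ₐ[k] R) (hξ : ∀ i, ξ (MvPolynomial.X i) = x i)
    (hη : ∀ i, η (MvPolynomial.X i) = y i) {r : R}
    (hr : r ∈ Algebra.adjoin k (Set.range x ∪ Set.range y)) :
    ∃ f : (I →₀ ℕ) →₀ Poly k I,
      r = f.sum fun b g => ξ g * η (MvPolynomial.monomial b 1) := by
  classical
  let N : ((I →₀ ℕ) →₀ Poly k I) →ₗ[k] R := Finsupp.lsum k fun b =>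
    (LinearMap.mulRight k (η (MvPolynomial.monomial b 1))) ∘ₗ ξ.toLinearMap
  have hN : ∀ b g, N (Finsupp.single b g) = ξ g * η (MvPolynomial.monomial b 1) := by
    intro b g
    simp [N]
  suffices hs : r ∈ LinearMap.range N by
    obtain ⟨f, rfl⟩ := hs
    exact ⟨f, by simp [N, Finsupp.lsum_apply, Finsupp.sum]⟩
  have hcomm : ∀ i g, y i * ξ g = ξ g * y i + ξ (MvPolynomial.pderiv i g) := by
    intro i g
    induction g using MvPolynomial.induction_on with
    | C a =>
      rw [← MvPolynomial.algebraMap_eq, AlgHom.commutes, Algebra.commutes,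
        MvPolynomial.algebraMap_eq, MvPolynomial.pderiv_C, map_zero, add_zero]
    | add f g hf hg =>
      simp only [map_add, mul_add, add_mul, hf, hg]
      abel
    | mul_X f j hf =>
      have hyx : y i * x j = x j * y i + ξ (MvPolynomial.pderiv i (MvPolynomial.X j)) := by
        by_cases hij : i = j
        · subst hij
          rw [h.yx_self, MvPolynomial.pderiv_X_self, map_one]
        · rw [h.yx_ne _ _ hij, MvPolynomial.pderiv_X_of_ne (Ne.symm hij), map_zero, add_zero]
      rw [map_mul, hξ, ← mul_assoc, hf, add_mul, mul_assoc, hyx, Derivation.leibniz]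
      simp only [smul_eq_mul, map_add, map_mul, mul_add, mul_assoc, hξ, add_assoc]
      congr 2
      rw [← hξ, ← map_mul, ← map_mul, mul_comm]
  have key : ∀ r ∈ Algebra.adjoin k (Set.range x ∪ Set.range y),
      ∀ n ∈ LinearMap.range N, r * n ∈ LinearMap.range N := by
    intro r hr
    induction hr using Algebra.adjoin_induction with
    | algebraMap c =>
      intro n hn
      rw [← Algebra.smul_def]
      exact Submodule.smul_mem _ _ hn
    | add a b _ _ ha hb =>
      intro n hn
      rw [add_mul]
      exact Submodule.add_mem _ (ha n hn) (hb n hn)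
    | mul a b _ _ ha hb =>
      intro n hn
      rw [mul_assoc]
      exact ha _ (hb n hn)
    | mem a ha =>
      rintro _ ⟨f, rfl⟩
      induction f using Finsupp.induction_linear with
      | zero => simp
      | add f g hf hg =>
        rw [map_add, mul_add]
        exact Submodule.add_mem _ hf hg
      | single b g =>
        rw [hN]
        rcases ha with ⟨i, rfl⟩ | ⟨i, rfl⟩
        · refine ⟨Finsupp.single b (MvPolynomial.X i * g), ?_⟩
          rw [hN, map_mul, hξ, mul_assoc]
        · refine ⟨Finsupp.single (Finsupp.single i 1 + b) g +
            Finsupp.single b (MvPolynomial.pderiv i g), ?_⟩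
          have hb : (MvPolynomial.monomial (Finsupp.single i 1 + b) (1 : k)) =
              MvPolynomial.X i * MvPolynomial.monomial b 1 := by
            rw [MvPolynomial.X, MvPolynomial.monomial_mul, one_mul]
          rw [map_add, hN, hN, ← mul_assoc, hcomm, add_mul, hb, map_mul, hη, mul_assoc]
  have h1 : (1 : R) ∈ LinearMap.range N :=
    ⟨Finsupp.single 0 1, by
      rw [hN, map_one, one_mul]
      exact map_one η⟩
  simpa using key r hr 1 h1

/-- The differential operators `∑ g_b ∂^b` with polynomial coefficients act faithfully on the
polynomial ring: evaluate at `x^b` for a minimal `b` with `g_b ≠ 0`. -/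
theorem normal_form_injective [CharZero k] (ξ η : Poly k I →ₐ[k] Module.End k (Poly k I))
    (hξ : ∀ i, ξ (MvPolynomial.X i) = mulX k I i)
    (hη : ∀ i, η (MvPolynomial.X i) = partialX k I i) (f : (I →₀ ℕ) →₀ Poly k I)
    (hf : (f.sum fun b g => ξ g * η (MvPolynomial.monomial b 1)) = 0) : f = 0 := by
  classical
  have hξ' : ξ = Algebra.lmul k (Poly k I) := by
    refine MvPolynomial.algHom_ext fun i => ?_
    rw [hξ]
    rfl
  by_contra hne
  obtain ⟨b, hb⟩ := f.support.exists_minimal (Finsupp.support_nonempty_iff.2 hne)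
  have h0 := congr($hf (MvPolynomial.monomial b 1))
  rw [Finsupp.sum, LinearMap.sum_apply, Finset.sum_eq_single b] at h0
  · obtain ⟨c, hc, hcb⟩ := exists_partial_monomial η hη b b
    rw [Module.End.mul_apply, hcb, hξ', tsub_self] at h0
    have : f b * MvPolynomial.C c = 0 := h0
    rcases mul_eq_zero.1 this with h | h
    · exact Finsupp.mem_support_iff.1 hb.prop h
    · exact hc.2 le_rfl (by simpa using h)
  · intro b' hb' hne'
    obtain ⟨c, hc, hcb⟩ := exists_partial_monomial η hη b' b
    have : c = 0 := by
      by_contra h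
      exact hne' (le_antisymm (hc.1 h) (hb.le_of_le hb' (hc.1 h)))
    rw [Module.End.mul_apply, hcb, this]
    simp
  · intro h
    exact absurd hb.prop h

/-- The Weyl algebra is presented by the Weyl relations: families of operators satisfying them
define a representation. Inside `End B × End V`, the algebra generated by the pairs of operators
consists of normal forms, and these are determined by their first component. -/
theorem exists_representation [CharZero k] {V : Type*} [AddCommGroup V] [Module k V]
    {x y : I → Module.End k V} (h : WeylRelations x y) :
    ∃ ρ : WeylAlgebra k I →ₐ[k] Module.End k V,
      (∀ i, ρ (genX k i) = x i) ∧ ∀ i, ρ (genY k i) = y i := by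
  let X : I → Module.End k (Poly k I) × Module.End k V := fun i => (mulX k I i, x i)
  let Y : I → Module.End k (Poly k I) × Module.End k V := fun i => (partialX k I i, y i)
  have hB := weylRelations_operators (k := k) (I := I)
  have hW : WeylRelations X Y :=
    { xx := fun i j => Prod.ext (hB.xx i j) (h.xx i j)
      yy := fun i j => Prod.ext (hB.yy i j) (h.yy i j)
      yx_ne := fun i j hij => Prod.ext (hB.yx_ne i j hij) (h.yx_ne i j hij)
      yx_self := fun i => Prod.ext (hB.yx_self i) (h.yx_self i) }
  obtain ⟨ξ, hξ⟩ := exists_algHom_of_commute (k := k) X hW.xx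
  obtain ⟨η, hη⟩ := exists_algHom_of_commute (k := k) Y hW.yy
  let S := Algebra.adjoin k (Set.range X ∪ Set.range Y)
  let fst := AlgHom.fst k (Module.End k (Poly k I)) (Module.End k V)
  let snd := AlgHom.snd k (Module.End k (Poly k I)) (Module.End k V)
  have hinj : Function.Injective (fst.comp S.val) := by
    rw [injective_iff_map_eq_zero]
    rintro ⟨r, hr⟩ h0
    obtain ⟨f, rfl⟩ := exists_normal_form hW ξ η hξ hη hr
    have hf : f = 0 := by
      refine normal_form_injective (fst.comp ξ) (fst.comp η) (fun i => by simp [hξ, X, fst])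
        (fun i => by simp [hη, Y, fst]) f ?_
      have h1 : fst (f.sum fun b g => ξ g * η (MvPolynomial.monomial b 1)) = 0 := h0
      rw [map_finsuppSum] at h1
      simpa using! h1
    subst hf
    rfl
  have hrange : (fst.comp S.val).range = weylSubalgebra k I := by
    rw [AlgHom.range_comp, Subalgebra.range_val, AlgHom.map_adjoin, Set.image_union,
      ← Set.range_comp, ← Set.range_comp]
    rfl
  let e := AlgEquiv.ofInjective (fst.comp S.val) hinj
  have hmem : ∀ a : WeylAlgebra k I, a.1 ∈ (fst.comp S.val).range := fun a => by
    rw [hrange]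
    exact a.2
  let j : WeylAlgebra k I →ₐ[k] (fst.comp S.val).range :=
    (weylSubalgebra k I).val.codRestrict _ hmem
  refine ⟨(snd.comp S.val).comp ((e.symm : _ →ₐ[k] S).comp j), fun i => ?_, fun i => ?_⟩
  · have : e.symm (j (genX k i)) = ⟨X i, Algebra.subset_adjoin (Or.inl ⟨i, rfl⟩)⟩ := by
      rw [AlgEquiv.symm_apply_eq]
      rfl
    exact congrArg (fun r : S => r.1.2) this
  · have : e.symm (j (genY k i)) = ⟨Y i, Algebra.subset_adjoin (Or.inr ⟨i, rfl⟩)⟩ := by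
      rw [AlgEquiv.symm_apply_eq]
      rfl
    exact congrArg (fun r : S => r.1.2) this

end Presentation

end Weyl

/-! ### Weight spaces -/

namespace Weyl

section Weights

variable {k I : Type u} [Field k]

theorem genT_comm (i j : I) : genT k i * genT k j = genT k j * genT k i := by
  have h := weylRelations_gen (k := k) (I := I)
  by_cases hij : i = j
  · rw [hij]
  · simp only [genT]
    rw [mul_assoc, ← mul_assoc (genY k i), h.yx_ne i j hij, mul_assoc, h.yy i j,
      ← mul_assoc, h.xx i j, mul_assoc, ← mul_assoc (genX k i), ← h.yx_ne j i (Ne.symm hij)]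
    simp only [mul_assoc]

theorem genT_mul_genX_self (i : I) : genT k i * genX k i = genX k i * genT k i + genX k i := by
  rw [genT, mul_assoc, (weylRelations_gen (k := k)).yx_self, mul_add, mul_one]

theorem genT_mul_genX_ne {i j : I} (h : i ≠ j) : genT k i * genX k j = genX k j * genT k i := by
  rw [genT, mul_assoc, (weylRelations_gen (k := k)).yx_ne i j h, ← mul_assoc,
    (weylRelations_gen (k := k)).xx, mul_assoc]

theorem genT_mul_genY_self (i : I) : genT k i * genY k i + genY k i = genY k i * genT k i := by
  rw [genT, ← mul_assoc, (weylRelations_gen (k := k)).yx_self, add_mul, one_mul]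

theorem genT_mul_genY_ne {i j : I} (h : i ≠ j) : genT k i * genY k j = genY k j * genT k i := by
  rw [genT, mul_assoc, (weylRelations_gen (k := k)).yy i j, ← mul_assoc,
    ← (weylRelations_gen (k := k)).yx_ne j i h.symm, mul_assoc]

/-- The Nullstellensatz for `A₀`: as `A₀` has dimension at most `|I| < |k|`, its residue fields are
equal to `k`, because a transcendental element `t` would give the linearly independent family
`1 / (t - a)`, `a ∈ k`. Hence a weight element is a simultaneous eigenvector of the `t i`. -/
theorem IsWeightElement.exists_eigenvalues [IsAlgClosed k] [Infinite I]
    (hI : Cardinal.mk I < Cardinal.mk k) {M : Type u} [AddCommGroup M] [Module k M]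
    [Module (WeylAlgebra k I) M] [IsScalarTower k (WeylAlgebra k I) M] {x : M}
    (hx : IsWeightElement (k := k) (I := I) x) : ∃ q : I → k, ∀ i, genT k i • x = q i • x := by
  obtain ⟨m, hm, hmx⟩ := hx
  obtain ⟨φ, hφ⟩ := exists_algHom_of_commute (k := k) (genT k (I := I)) genT_comm
  have hrange : φ.range = cartan k I := by
    rw [← Algebra.map_top, ← MvPolynomial.adjoin_range_X, AlgHom.map_adjoin, ← Set.range_comp,
      show φ ∘ MvPolynomial.X = genT k from funext hφ, cartan]
  let π : MvPolynomial I k →ₐ[k] cartan k I := φ.codRestrict _ fun f => by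
    rw [← hrange]
    exact ⟨f, rfl⟩
  have hπ : Function.Surjective π := by
    rintro ⟨a, ha⟩
    rw [← hrange] at ha
    obtain ⟨f, rfl⟩ := ha
    exact ⟨f, rfl⟩
  let n : Ideal (MvPolynomial I k) := m.comap π
  have hn : n.IsMaximal := by
    refine ⟨⟨fun h => hm.ne_top ?_, fun J hJ => ?_⟩⟩
    · rw [Ideal.eq_top_iff_one] at h ⊢
      have : π 1 ∈ m := h
      rwa [map_one] at this
    · have hJm : m < J.map π := by
        obtain ⟨f, hfJ, hfn⟩ := SetLike.exists_of_lt hJ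
        refine SetLike.lt_iff_le_and_exists.2
          ⟨fun a ha => ?_, π f, Ideal.mem_map_of_mem π hfJ, hfn⟩
        obtain ⟨g, rfl⟩ := hπ a
        exact Ideal.mem_map_of_mem π (hJ.le ha)
      have h1 : (1 : cartan k I) ∈ J.map π := by
        rw [hm.1.2 _ hJm]
        exact Submodule.mem_top
      obtain ⟨g, hg, hg1⟩ := (Ideal.mem_map_iff_of_surjective π hπ).1 h1
      have h2 : 1 - g ∈ n := by
        have h3 : φ (1 - g) = 0 := by
          have : φ g = 1 := congrArg Subtype.val hg1
          rw [map_sub, map_one, this, sub_self]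
        change π (1 - g) ∈ m
        rw [show π (1 - g) = 0 from Subtype.ext h3]
        exact m.zero_mem
      rw [Ideal.eq_top_iff_one]
      simpa using J.add_mem (hJ.le h2) hg
  let : Field (MvPolynomial I k ⧸ n) := Ideal.Quotient.field n
  have hrank : Module.rank k (MvPolynomial I k ⧸ n) ≤ Cardinal.mk I := by
    refine (LinearMap.rank_le_of_surjective (Ideal.Quotient.mkₐ k n).toLinearMap
      (Ideal.Quotient.mkₐ_surjective k n)).trans ?_
    rw [MvPolynomial.rank_eq]
    simp
  have halg : Algebra.IsIntegral k (MvPolynomial I k ⧸ n) := by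
    rw [← Algebra.isAlgebraic_iff_isIntegral, Algebra.isAlgebraic_def]
    intro z
    by_contra hz
    have := (show Transcendental k z from hz).linearIndependent_sub_inv.cardinal_le_rank
    exact absurd (this.trans hrank) (not_le.2 hI)
  have hsurj := (IsAlgClosed.algebraMap_bijective_of_isIntegral (k := k)
    (K := MvPolynomial I k ⧸ n)).surjective
  choose q hq using fun i => hsurj (Ideal.Quotient.mk n (MvPolynomial.X i))
  refine ⟨q, fun i => ?_⟩
  have hi : MvPolynomial.X i + MvPolynomial.C (-q i) ∈ n := by
    rw [map_neg, ← sub_eq_add_neg, ← Ideal.Quotient.eq_zero_iff_mem, map_sub, ← hq i, sub_eq_zero]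
    rfl
  have h1 : φ (MvPolynomial.X i + MvPolynomial.C (-q i)) • x = 0 := hmx _ hi
  rw [map_add, hφ, ← MvPolynomial.algebraMap_eq, AlgHom.commutes, add_smul, algebraMap_smul,
    neg_smul, ← sub_eq_add_neg, sub_eq_zero] at h1
  exact h1

/-- The subalgebra `A₀` acts by scalars on a simultaneous eigenvector of the `t i`, so that the
annihilator of the eigenvector in `A₀` is maximal. -/
theorem isWeightElement_of_eigenvalues {M : Type u} [AddCommGroup M] [Module k M]
    [Module (WeylAlgebra k I) M] [IsScalarTower k (WeylAlgebra k I) M] {x : M} (hx : x ≠ 0)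
    (q : I → k) (h : ∀ i, genT k i • x = q i • x) : IsWeightElement (k := k) (I := I) x := by
  have hs : ∀ a ∈ cartan k I, ∃ c : k, a • x = c • x := by
    intro a ha
    induction ha using Algebra.adjoin_induction with
    | mem a ha =>
      obtain ⟨i, rfl⟩ := ha
      exact ⟨q i, h i⟩
    | algebraMap c => exact ⟨c, algebraMap_smul _ c x⟩
    | add a b _ _ ha hb =>
      obtain ⟨c, hc⟩ := ha
      obtain ⟨d, hd⟩ := hb
      exact ⟨c + d, by rw [add_smul, add_smul, hc, hd]⟩
    | mul a b _ _ ha hb =>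
      obtain ⟨c, hc⟩ := ha
      obtain ⟨d, hd⟩ := hb
      exact ⟨d * c, by rw [mul_smul, hd, smul_algebra_smul_comm, hc, smul_smul]⟩
  let m : Ideal (cartan k I) :=
    { carrier := {a | (a : WeylAlgebra k I) • x = 0}
      zero_mem' := zero_smul _ x
      add_mem' := fun {a b} ha hb => by
        have ha : (a : WeylAlgebra k I) • x = 0 := ha
        have hb : (b : WeylAlgebra k I) • x = 0 := hb
        change ((a : WeylAlgebra k I) + b) • x = 0
        rw [add_smul, ha, hb, add_zero]
      smul_mem' := fun a b hb => by
        have hb : (b : WeylAlgebra k I) • x = 0 := hb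
        change ((a : WeylAlgebra k I) * b) • x = 0
        rw [mul_smul, hb, smul_zero] }
  have hmem : ∀ a : cartan k I, a ∈ m ↔ (a : WeylAlgebra k I) • x = 0 := fun a => Iff.rfl
  refine ⟨m, ⟨⟨?_, ?_⟩⟩, fun a ha => ha⟩
  · rw [Ne, Ideal.eq_top_iff_one, hmem]
    change ¬ ((1 : WeylAlgebra k I) • x = 0)
    rwa [one_smul]
  · intro n hn
    obtain ⟨a, han, ham⟩ := SetLike.exists_of_lt hn
    obtain ⟨c, hc⟩ := hs a a.2
    have hc0 : c ≠ 0 := by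
      rintro rfl
      exact ham ((hmem a).2 (by rw [hc, zero_smul]))
    rw [Ideal.eq_top_iff_one]
    have h1 : 1 + (-c⁻¹) • a ∈ m := by
      rw [hmem]
      change ((1 : WeylAlgebra k I) + (-c⁻¹) • (a : WeylAlgebra k I)) • x = 0
      rw [add_smul, one_smul, smul_assoc, hc, smul_smul, neg_mul, inv_mul_cancel₀ hc0, neg_smul,
        one_smul, add_neg_cancel]
    have h2 : c⁻¹ • a ∈ n := n.smul_of_tower_mem c⁻¹ han
    have h3 := n.add_mem (hn.le h1) h2
    rwa [add_assoc, ← add_smul, neg_add_cancel, zero_smul, add_zero] at h3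

/-- A subspace stable under the `t i` contains the components of its elements with respect to
distinct weights. -/
theorem mem_of_sum_mem {M : Type*} [AddCommGroup M] [Module k M]
    [Module (WeylAlgebra k I) M] [IsScalarTower k (WeylAlgebra k I) M] {ι : Type*}
    (q : ι → I → k) (hq : Function.Injective q)
    (N : Submodule k M)
    (hN : ∀ i : I, ∀ x ∈ N, genT k i • x ∈ N) (s : Finset ι) (y : ι → M)
    (hy : ∀ a ∈ s, ∀ i, genT k i • y a = q a i • y a) (hs : ∑ a ∈ s, y a ∈ N) :
    ∀ a ∈ s, y a ∈ N := by
  classical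
  induction s using Finset.induction generalizing y with
  | empty => simp
  | insert b s hb ih =>
    have key : ∀ a ∈ s, y a ∈ N := by
      intro a ha
      have hab : a ≠ b := fun h => hb (h ▸ ha)
      obtain ⟨i, hi⟩ := Function.ne_iff.1 (hq.ne hab)
      have h1 := ih (fun c => (q c i - q b i) • y c) (fun c hc j => by
        rw [smul_algebra_smul_comm, hy c (Finset.mem_insert_of_mem hc), smul_comm]) (by
        have h2 := N.sub_mem (hN i _ hs) (N.smul_mem (q b i) hs)
        rw [Finset.smul_sum, Finset.smul_sum, ← Finset.sum_sub_distrib, Finset.sum_insert hb,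
          hy b (Finset.mem_insert_self _ _), sub_self, zero_add] at h2
        convert h2 using 1
        refine Finset.sum_congr rfl fun c hc => ?_
        rw [hy c (Finset.mem_insert_of_mem hc), sub_smul]) a ha
      have h3 := N.smul_mem (q a i - q b i)⁻¹ h1
      rwa [smul_smul, inv_mul_cancel₀ (sub_ne_zero.2 hi), one_smul] at h3
    intro a ha
    rcases Finset.mem_insert.1 ha with rfl | ha
    · rw [Finset.sum_insert hb] at hs
      exact (N.add_mem_iff_left (N.sum_mem key)).1 hs
    · exact key a ha

/-- The weight space of weight `p + v`, for a lattice vector `v`. -/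
def latticeWeightSpace (p : I → k) (M : Type*) [AddCommGroup M] [Module k M]
    [Module (WeylAlgebra k I) M] [IsScalarTower k (WeylAlgebra k I) M] (v : I →₀ ℤ) :
    Submodule k M where
  carrier := {x | ∀ i, genT k i • x = (p i + (v i : k)) • x}
  zero_mem' i := by simp
  add_mem' hx hy i := by rw [smul_add, smul_add, hx i, hy i]
  smul_mem' c x hx i := by rw [smul_algebra_smul_comm, hx i, smul_comm]

section

variable {p : I → k} {M : Type*} [AddCommGroup M] [Module k M]
    [Module (WeylAlgebra k I) M] [IsScalarTower k (WeylAlgebra k I) M]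

theorem genX_smul_mem {v : I →₀ ℤ} {x : M} (hx : x ∈ latticeWeightSpace p M v) (i : I) :
    genX k i • x ∈ latticeWeightSpace p M (v + Finsupp.single i 1) := by
  intro j
  by_cases h : j = i
  · subst h
    rw [← mul_smul, genT_mul_genX_self, add_smul, mul_smul, hx j, smul_algebra_smul_comm,
      Finsupp.add_apply, Finsupp.single_eq_same, Int.cast_add, Int.cast_one, ← add_assoc,
      add_smul _ 1, one_smul]
  · rw [← mul_smul, genT_mul_genX_ne h, mul_smul, hx j, smul_algebra_smul_comm,
      Finsupp.add_apply, Finsupp.single_eq_of_ne h, add_zero]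

theorem genY_smul_mem {v : I →₀ ℤ} {x : M} (hx : x ∈ latticeWeightSpace p M v) (i : I) :
    genY k i • x ∈ latticeWeightSpace p M (v - Finsupp.single i 1) := by
  intro j
  by_cases h : j = i
  · subst h
    have h := congrArg (· • x) (genT_mul_genY_self (k := k) j)
    simp only [add_smul, mul_smul] at h
    rw [hx j, smul_algebra_smul_comm, ← eq_sub_iff_add_eq] at h
    rw [h, Finsupp.sub_apply, Finsupp.single_eq_same, Int.cast_sub, Int.cast_one, ← add_sub_assoc,
      sub_smul _ (1 : k), one_smul]
  · rw [← mul_smul, genT_mul_genY_ne h, mul_smul, hx j, smul_algebra_smul_comm,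
      Finsupp.sub_apply, Finsupp.single_eq_of_ne h, sub_zero]

theorem genX_smul_genY_smul {v : I →₀ ℤ} {x : M} (hx : x ∈ latticeWeightSpace p M v) (i : I) :
    genX k i • genY k i • x = (p i + (v i : k)) • x := by
  rw [← mul_smul]
  exact hx i

theorem genY_smul_genX_smul {v : I →₀ ℤ} {x : M} (hx : x ∈ latticeWeightSpace p M v) (i : I) :
    genY k i • genX k i • x = (p i + (v i : k) + 1) • x := by
  rw [← mul_smul, (weylRelations_gen (k := k)).yx_self, add_smul, one_smul, add_smul, one_smul]
  exact congrArg (· + x) (hx i)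

open scoped ModuleCat in
/-- A module in the block of `p` is the sum of its weight spaces with weights in `p + ℤ_f^I`. -/
theorem iSup_latticeWeightSpace_eq_top [IsAlgClosed k] [Infinite I]
    (hI : Cardinal.mk I < Cardinal.mk k) {M : ModuleCat.{u} (WeylAlgebra k I)}
    (hM : blockProperty p M) : ⨆ v, latticeWeightSpace p M v = ⊤ := by
  obtain ⟨⟨s, hs, hli, hspan⟩, hsupp⟩ := hM
  rw [eq_top_iff, ← hspan, Submodule.span_le]
  intro x hx
  obtain ⟨q, hq⟩ := (hs x hx).exists_eigenvalues hI
  obtain ⟨v, hv⟩ := hsupp ⟨x, hq, hli.ne_zero hx⟩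
  refine Submodule.mem_iSup_of_mem v fun i => ?_
  rw [hq i, hv i]

variable [CharZero k]

theorem latticeWeight_injective (p : I → k) :
    Function.Injective fun (v : I →₀ ℤ) i => p i + (v i : k) := by
  intro v w h
  ext i
  simpa using congrFun h i

theorem iSupIndep_latticeWeightSpace (p : I → k) (M : Type*) [AddCommGroup M] [Module k M]
    [Module (WeylAlgebra k I) M] [IsScalarTower k (WeylAlgebra k I) M] :
    iSupIndep (latticeWeightSpace p M) := by
  classical
  refine iSupIndep_of_dfinsupp_lsum_injective _ ?_
  rw [injective_iff_map_eq_zero]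
  intro f hf
  rw [DFinsupp.lsum_apply_apply, DFinsupp.sumAddHom_apply, DFinsupp.sum] at hf
  ext v
  by_cases hv : v ∈ f.support
  · exact mem_of_sum_mem _ (latticeWeight_injective p) ⊥ (by simp) f.support (fun v => (f v : M))
      (fun v _ => (f v).2) (by simpa using hf) v hv
  · simpa using hv

theorem isInternal_latticeWeightSpace [DecidableEq (I →₀ ℤ)]
    (h : ⨆ v, latticeWeightSpace p M v = ⊤) :
    DirectSum.IsInternal (latticeWeightSpace p M) :=
  DirectSum.isInternal_submodule_of_iSupIndep_of_iSup_eq_top (iSupIndep_latticeWeightSpace p M) h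

open scoped ModuleCat in
/-- The special case of `blockProperty_of_iSup_eq_top` in which `k` acts by restriction of
scalars. -/
theorem blockProperty_of_iSup_eq_top' {M : ModuleCat.{u} (WeylAlgebra k I)}
    (h : ⨆ v, latticeWeightSpace p M v = ⊤) : blockProperty p M := by
  constructor
  · obtain ⟨b, hb, hspan, hli⟩ := exists_linearIndependent k
      (⋃ v, (latticeWeightSpace p M v : Set M))
    refine ⟨b, fun x hx => ?_, hli, ?_⟩
    · obtain ⟨v, hv⟩ := Set.mem_iUnion.1 (hb hx)
      exact isWeightElement_of_eigenvalues (hli.ne_zero (⟨x, hx⟩ : b)) _ hv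
    · rw [hspan, ← Submodule.iSup_eq_span, h]
  · rintro q ⟨x, hx, hx0⟩
    by_contra hq
    have hxtop : x ∈ ⨆ v, latticeWeightSpace p M v := h ▸ Submodule.mem_top
    obtain ⟨f, hf, hfx⟩ := (Submodule.mem_iSup_iff_exists_finsupp _ _).1 hxtop
    refine hx0 ?_
    have hinj : Function.Injective fun o : Option (I →₀ ℤ) =>
        o.elim q fun v i => p i + (v i : k) := by
      rintro (_ | v) (_ | w) hvw
      · rfl
      · exact absurd ⟨w, fun i => congrFun hvw i⟩ hq
      · exact absurd ⟨v, fun i => (congrFun hvw i).symm⟩ hq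
      · exact congrArg _ (latticeWeight_injective p hvw)
    have := mem_of_sum_mem (M := M) _ hinj ⊥ (by simp) (Finset.insertNone f.support)
      (fun o => o.elim (-x) f) (by
        rintro (_ | v) _ i
        · change genT k i • -x = q i • -x
          rw [smul_neg, smul_neg, hx i]
        · exact hf v i) (by
        rw [Finset.sum_insertNone]
        change -x + ∑ v ∈ f.support, f v ∈ _
        rw [← hfx, Finsupp.sum]
        simp) none (by simp)
    simpa using this

/-- A module which is the sum of its weight spaces with weights in `p + ℤ_f^I` belongs to the block
of `p`. -/
theorem blockProperty_of_iSup_eq_top {M : Type u} [AddCommGroup M] [inst : Module k M]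
    [Module (WeylAlgebra k I) M] [IsScalarTower k (WeylAlgebra k I) M]
    (h : ⨆ v, latticeWeightSpace p M v = ⊤) :
    blockProperty p (ModuleCat.of (WeylAlgebra k I) M) := by
  obtain rfl : inst = Module.restrictScalars k (WeylAlgebra k I) M := by
    refine Module.ext' _ _ fun c x => ?_
    exact (algebraMap_smul (WeylAlgebra k I) c x).symm
  exact blockProperty_of_iSup_eq_top' h

end

end Weights

end Weyl

/-! ### Geodesics in the quiver of finite subsets -/

namespace SubsetQuiver

variable {k E : Type u} [Field k]

/-- The symmetric difference of two vertices of `Q_E`, as a set. -/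
def diff (U W : Vertex E) : Set E := symmDiff (U.carrier : Set E) (W.carrier : Set E)

theorem mem_diff {U W : Vertex E} {e : E} :
    e ∈ diff U W ↔ ¬ (e ∈ U.carrier ↔ e ∈ W.carrier) := by
  simp only [diff, Set.mem_symmDiff, Finset.mem_coe]
  tauto

theorem diff_finite (U W : Vertex E) : (diff U W).Finite :=
  (U.carrier.finite_toSet.union W.carrier.finite_toSet).subset Set.symmDiff_subset_union

theorem diff_self (U : Vertex E) : diff U U = ∅ := symmDiff_self _

theorem diff_comm (U W : Vertex E) : diff U W = diff W U := symmDiff_comm _ _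

theorem disjoint_diff_of_eq_left {U W : Vertex E} (h : U = W) (Z : Vertex E) :
    Disjoint (diff U W) (diff W Z) := by
  rw [h, diff_self]
  exact Set.empty_disjoint _

theorem disjoint_diff_of_eq_right {W Z : Vertex E} (h : W = Z) (U : Vertex E) :
    Disjoint (diff U W) (diff W Z) := by
  rw [h, diff_self]
  exact Set.disjoint_empty _

theorem eq_of_diff_eq {U W W' : Vertex E} (h : diff U W = diff U W') : W = W' := by
  cases W
  cases W'
  congr
  ext e
  have := congrArg (e ∈ ·) h
  simp only [mem_diff, eq_iff_iff] at this
  tauto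

theorem eq_of_diff_eq_empty {U W : Vertex E} (h : diff U W = ∅) : U = W :=
  eq_of_diff_eq (U := U) (by rw [h, diff_self])

theorem exists_diff_eq_singleton (U : Vertex E) (e : E) : ∃ W : Vertex E, diff W U = {e} := by
  classical
  refine ⟨⟨symmDiff U.carrier {e}⟩, ?_⟩
  ext a
  simp only [mem_diff, Finset.mem_symmDiff, Finset.mem_singleton, Set.mem_singleton_iff]
  tauto

theorem diff_triangle (U V W : Vertex E) : diff U W = symmDiff (diff U V) (diff V W) := by
  ext e
  simp only [Set.mem_symmDiff, mem_diff]
  tauto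

theorem diff_step_of_notMem {U V W : Vertex E} {e : E} (h : diff V W = {e}) (he : e ∉ diff U V) :
    diff U W = insert e (diff U V) := by
  rw [diff_triangle U V W, h]
  ext a
  simp only [Set.mem_symmDiff, Set.mem_singleton_iff, Set.mem_insert_iff]
  by_cases ha : a = e
  · subst ha
    tauto
  · tauto

theorem diff_step_of_mem {U V W : Vertex E} {e : E} (h : diff V W = {e}) (he : e ∈ diff U V) :
    diff U W = diff U V \ {e} := by
  rw [diff_triangle U V W, h]
  ext a
  simp only [Set.mem_symmDiff, Set.mem_singleton_iff, Set.mem_sdiff]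
  by_cases ha : a = e
  · subst ha
    tauto
  · tauto

theorem ncard_diff_step_of_notMem {U V W : Vertex E} {e : E} (h : diff V W = {e})
    (he : e ∉ diff U V) : (diff U W).ncard = (diff U V).ncard + 1 := by
  rw [diff_step_of_notMem h he, Set.ncard_insert_of_notMem he (diff_finite U V)]

theorem ncard_diff_step_of_mem {U V W : Vertex E} {e : E} (h : diff V W = {e})
    (he : e ∈ diff U V) : (diff U W).ncard + 1 = (diff U V).ncard := by
  rw [diff_step_of_mem h he, Set.ncard_sdiff_singleton_add_one he (diff_finite U V)]

theorem exists_diff_eq_of_hom {U W : Vertex E} (f : U ⟶ W) : ∃ e, diff U W = {e} := f.down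

instance (U W : Vertex E) : Subsingleton (U ⟶ W) :=
  ⟨fun f g => congrArg PLift.up (Subsingleton.elim f.down g.down)⟩

/-- The arrow of `Q_E` between vertices whose symmetric difference is a singleton. -/
def homOfDiff {U W : Vertex E} {e : E} (h : diff U W = {e}) : U ⟶ W := ⟨e, h⟩

variable (k)

/-- A vertex, as an object of `C_E`. -/
noncomputable def vtx (U : Vertex E) : PathCat k E :=
  (Quotient.functor (Rel k (E := E))).obj (vertex k U)

/-- The morphism of `C_E` defined by a path. -/
noncomputable def pathHom {U W : Vertex E} (a : Quiver.Path U W) : vtx k U ⟶ vtx k W :=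
  (Quotient.functor (Rel k (E := E))).map
    ((Free.embedding k (Paths (Vertex E))).map (X := (Paths.of (Vertex E)).obj U)
      (Y := (Paths.of (Vertex E)).obj W) a)

/-- The morphism of `C_E` defined by an arrow. -/
noncomputable def arr {U W : Vertex E} (f : U ⟶ W) : vtx k U ⟶ vtx k W :=
  (Quotient.functor (Rel k (E := E))).map (arrow k f)

theorem pathHom_nil (U : Vertex E) : pathHom k (Quiver.Path.nil : Quiver.Path U U) = 𝟙 _ := by
  refine Eq.trans ?_ ((Quotient.functor (Rel k (E := E))).map_id _)
  exact congrArg (Quotient.functor (Rel k (E := E))).map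
    ((Free.embedding k (Paths (Vertex E))).map_id _)

theorem pathHom_comp {U V W : Vertex E} (a : Quiver.Path U V) (b : Quiver.Path V W) :
    pathHom k (a.comp b) = pathHom k a ≫ pathHom k b := by
  refine Eq.trans ?_ ((Quotient.functor (Rel k (E := E))).map_comp _ _)
  exact congrArg (Quotient.functor (Rel k (E := E))).map
    ((Free.embedding k (Paths (Vertex E))).map_comp (X := (Paths.of (Vertex E)).obj U)
      (Y := (Paths.of (Vertex E)).obj V) (Z := (Paths.of (Vertex E)).obj W) a b)

theorem pathHom_cons {U V W : Vertex E} (a : Quiver.Path U V) (f : V ⟶ W) :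
    pathHom k (a.cons f) = pathHom k a ≫ arr k f :=
  pathHom_comp k a f.toPath

theorem arr_comp_arr_eq_zero {U W : Vertex E} (f : U ⟶ W) (g : W ⟶ U) :
    arr k f ≫ arr k g = 0 := by
  have h := CategoryTheory.Quotient.sound _ (Rel.cycle (k := k) f g)
  rw [Functor.map_comp, Functor.map_zero] at h
  exact h

theorem arr_square {U W U' W' : Vertex E} (a : U ⟶ W) (b : W ⟶ W') (a' : U ⟶ U') (b' : U' ⟶ W')
    (h : [U, W, U', W'].Nodup) : arr k a ≫ arr k b = arr k a' ≫ arr k b' := by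
  have h := CategoryTheory.Quotient.sound _ (Rel.square (k := k) a b a' b' h)
  rw [Functor.map_comp, Functor.map_comp] at h
  exact h

theorem exists_geodesic (U W : Vertex E) :
    ∃ a : Quiver.Path U W, a.length = (diff U W).ncard := by
  induction hn : (diff U W).ncard generalizing W with
  | zero =>
    rw [Set.ncard_eq_zero (diff_finite U W)] at hn
    obtain rfl := eq_of_diff_eq_empty hn
    exact ⟨Quiver.Path.nil, rfl⟩
  | succ n ih =>
    obtain ⟨e, he⟩ : (diff U W).Nonempty := by
      rw [← Set.ncard_pos (diff_finite U W)]
      omega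
    obtain ⟨V, hV⟩ := exists_diff_eq_singleton W e
    have hc := ncard_diff_step_of_mem (U := U) (diff_comm V W ▸ hV) he
    obtain ⟨a, ha⟩ := ih V (by omega)
    exact ⟨a.cons (homOfDiff hV), by rw [Quiver.Path.length_cons, ha]⟩

theorem ncard_diff_le_length {U W : Vertex E} (a : Quiver.Path U W) :
    (diff U W).ncard ≤ a.length := by
  induction a with
  | nil => simp [diff_self]
  | @cons V W a f ih =>
    obtain ⟨e, he⟩ := exists_diff_eq_of_hom f
    rw [Quiver.Path.length_cons]
    by_cases h : e ∈ diff U V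
    · have := ncard_diff_step_of_mem he h
      omega
    · have := ncard_diff_step_of_notMem he h
      omega

/-- Two shortest paths between the same vertices agree in `C_E`, by the square relations. -/
theorem pathHom_eq_of_geodesic {U W : Vertex E} (a b : Quiver.Path U W)
    (ha : a.length = (diff U W).ncard) (hb : b.length = (diff U W).ncard) :
    pathHom k a = pathHom k b := by
  induction hn : (diff U W).ncard generalizing W with
  | zero =>
    rw [hn] at ha hb
    obtain rfl := Quiver.Path.eq_of_length_zero a ha
    rw [Quiver.Path.length_eq_zero_iff] at ha hb
    rw [ha, hb]
  | succ n ih =>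
    rw [hn] at ha hb
    cases a with
    | nil => simp at ha
    | @cons V _ a f =>
    cases b with
    | nil => simp at hb
    | @cons V' _ b g =>
    rw [Quiver.Path.length_cons, Nat.add_right_cancel_iff] at ha hb
    obtain ⟨i, hi⟩ := exists_diff_eq_of_hom f
    obtain ⟨j, hj⟩ := exists_diff_eq_of_hom g
    have hiV : i ∉ diff U V := fun h => by
      have h1 := ncard_diff_step_of_mem hi h
      have h2 := ncard_diff_le_length a
      omega
    have hjV : j ∉ diff U V' := fun h => by
      have h1 := ncard_diff_step_of_mem hj h
      have h2 := ncard_diff_le_length b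
      omega
    have hV := ncard_diff_step_of_notMem hi hiV
    have hV' := ncard_diff_step_of_notMem hj hjV
    rw [pathHom_cons, pathHom_cons]
    by_cases hVV : V = V'
    · subst hVV
      rw [ih a b (by omega) (by omega) (by omega), Subsingleton.elim f g]
    · -- The square formed by the last vertices `V`, `V'`, `W` of the two paths and by the vertex
      -- `Z` obtained from `V` by undoing the last step of the other path.
      have hij : i ≠ j := by
        rintro rfl
        exact hVV (eq_of_diff_eq (U := W) (by rw [diff_comm, hi, diff_comm, hj]))
      have hjU : j ∈ diff U V := by
        have h1 : j ∈ diff U W := by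
          rw [diff_step_of_notMem hj hjV]
          exact Set.mem_insert _ _
        rw [diff_step_of_notMem hi hiV] at h1
        exact h1.resolve_left hij.symm
      obtain ⟨Z, hZ⟩ := exists_diff_eq_singleton V j
      have hZV' : diff Z V' = {i} := by
        rw [diff_triangle Z V V', diff_triangle V W V', hZ, hi, diff_comm, hj]
        ext a
        simp only [Set.mem_symmDiff, Set.mem_singleton_iff]
        grind
      have hZW : diff Z W = {i, j} := by
        rw [diff_triangle Z V W, hZ, hi]
        ext a
        simp only [Set.mem_symmDiff, Set.mem_singleton_iff, Set.mem_insert_iff]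
        grind
      obtain ⟨z, hz⟩ := exists_geodesic U Z
      have hUZ := ncard_diff_step_of_mem (U := U) (diff_comm Z V ▸ hZ) hjU
      have hUZ' : (diff U V').ncard = (diff U Z).ncard + 1 := by omega
      have h1 := ih a (z.cons (homOfDiff hZ)) (by omega)
        (by rw [Quiver.Path.length_cons]; omega) (by omega)
      have h2 := ih b (z.cons (homOfDiff hZV')) (by omega)
        (by rw [Quiver.Path.length_cons]; omega) (by omega)
      have hne : ∀ {X Y : Vertex E} {s : Set E}, diff X Y = s → s.Nonempty → X ≠ Y := by
        rintro X Y s h hs rfl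
        rw [diff_self] at h
        exact hs.ne_empty h.symm
      rw [h1, h2, pathHom_cons, pathHom_cons, Category.assoc, Category.assoc,
        arr_square k (homOfDiff hZ) f (homOfDiff hZV') g]
      have n1 := hne hZ ⟨j, rfl⟩
      have n2 := hne hZV' ⟨i, rfl⟩
      have n3 := hne hZW ⟨i, Or.inl rfl⟩
      have n4 := hne hi ⟨i, rfl⟩
      have n5 := hne hj ⟨j, rfl⟩
      simp [n1, n2, n3, n4, n5, hVV]

/-- A path which is not a shortest path vanishes in `C_E`: move along geodesics until the first
step back, and replace the geodesic by one whose last arrow is opposite to that step. -/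
theorem pathHom_eq_zero {U W : Vertex E} (a : Quiver.Path U W)
    (ha : (diff U W).ncard < a.length) : pathHom k a = 0 := by
  induction a with
  | nil => simp at ha
  | @cons V W a f ih =>
    rw [Quiver.Path.length_cons] at ha
    rw [pathHom_cons]
    by_cases h : (diff U V).ncard < a.length
    · rw [ih h, Limits.zero_comp]
    · have hle := ncard_diff_le_length a
      obtain ⟨e, he⟩ := exists_diff_eq_of_hom f
      have hmem : e ∈ diff U V := by
        by_contra h1
        have := ncard_diff_step_of_notMem he h1
        omega
      have hc := ncard_diff_step_of_mem he hmem
      obtain ⟨z, hz⟩ := exists_geodesic U W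
      rw [pathHom_eq_of_geodesic k a (z.cons (homOfDiff (diff_comm V W ▸ he))) (by omega)
        (by rw [Quiver.Path.length_cons]; omega), pathHom_cons, Category.assoc,
        arr_comp_arr_eq_zero, Limits.comp_zero]

/-- The morphism of `C_E` given by the shortest paths from `U` to `W`. -/
noncomputable def canon (U W : Vertex E) : vtx k U ⟶ vtx k W :=
  pathHom k (exists_geodesic U W).choose

theorem pathHom_eq_canon {U W : Vertex E} (a : Quiver.Path U W)
    (ha : a.length = (diff U W).ncard) : pathHom k a = canon k U W :=
  pathHom_eq_of_geodesic k _ _ ha (exists_geodesic U W).choose_spec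

theorem canon_self (U : Vertex E) : canon k U U = 𝟙 _ := by
  rw [← pathHom_nil, pathHom_eq_canon]
  simp [diff_self]

theorem arr_eq_canon {U W : Vertex E} (f : U ⟶ W) : arr k f = canon k U W := by
  rw [← pathHom_eq_canon k f.toPath, ← Category.id_comp (arr k f), ← pathHom_nil, ← pathHom_cons]
  · rfl
  · obtain ⟨e, he⟩ := exists_diff_eq_of_hom f
    rw [he, Set.ncard_singleton]
    rfl

theorem canon_comp {U V W : Vertex E} (h : Disjoint (diff U V) (diff V W)) :
    canon k U V ≫ canon k V W = canon k U W := by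
  rw [canon, canon, ← pathHom_comp, pathHom_eq_canon]
  rw [Quiver.Path.length_comp, (exists_geodesic U V).choose_spec,
    (exists_geodesic V W).choose_spec, diff_triangle U V W, h.symmDiff_eq_sup]
  exact (Set.ncard_union_eq h (diff_finite _ _) (diff_finite _ _)).symm

theorem canon_comp_eq_zero {U V W : Vertex E} (h : ¬ Disjoint (diff U V) (diff V W)) :
    canon k U V ≫ canon k V W = 0 := by
  rw [canon, canon, ← pathHom_comp, pathHom_eq_zero]
  rw [Quiver.Path.length_comp, (exists_geodesic U V).choose_spec,
    (exists_geodesic V W).choose_spec, diff_triangle U V W]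
  have h1 := Set.ncard_union_add_ncard_inter (diff U V) (diff V W) (diff_finite _ _)
    (diff_finite _ _)
  have h2 := Set.ncard_le_ncard (Set.symmDiff_subset_union (s := diff U V) (t := diff V W))
    ((diff_finite _ _).union (diff_finite _ _))
  have h3 : 0 < (diff U V ∩ diff V W).ncard := by
    rw [Set.ncard_pos ((diff_finite _ _).inter_of_left _)]
    exact Set.not_disjoint_iff_nonempty_inter.1 h
  omega

end SubsetQuiver

/-! ### Modules over `C_E` as systems of vector spaces -/

namespace SubsetQuiver

section FreeLift

variable {k : Type*} [Field k] {C D : Type*} [Category* C] [Category* D] [Preadditive D]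
  [Linear k D]

/-- The action on morphisms of the extension of a functor to formal linear combinations. -/
noncomputable def freeLiftHom (F : C ⥤ D) {X Y : C} : ((X ⟶ Y) →₀ k) →ₗ[k] (F.obj X ⟶ F.obj Y) :=
  Finsupp.linearCombination k fun f => F.map f

theorem freeLiftHom_single (F : C ⥤ D) {X Y : C} (f : X ⟶ Y) (r : k) :
    freeLiftHom F (Finsupp.single f r) = r • F.map f :=
  Finsupp.linearCombination_single k r f

theorem freeLiftHom_comp (F : C ⥤ D) {X Y Z : C} (f : (X ⟶ Y) →₀ k) (g : (Y ⟶ Z) →₀ k) :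
    freeLiftHom F (f.sum fun f' s => g.sum fun g' t => Finsupp.single (f' ≫ g') (s * t)) =
      freeLiftHom F f ≫ freeLiftHom F g := by
  have h : ∀ {X Y : C} (f : (X ⟶ Y) →₀ k),
      freeLiftHom F f = ∑ f' ∈ f.support, f f' • F.map f' := fun f =>
    Finsupp.linearCombination_apply k f
  rw [h f, h g]
  simp only [Finsupp.sum, map_sum, freeLiftHom_single, Preadditive.sum_comp, Preadditive.comp_sum,
    Linear.smul_comp, Linear.comp_smul, F.map_comp, mul_smul]
  rw [Finset.sum_comm]
  refine Finset.sum_congr rfl fun g' _ => ?_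
  rw [Finset.smul_sum]
  exact Finset.sum_congr rfl fun f' _ => smul_comm _ _ _

/-- The extension of a functor to a `k`-linear category to formal linear combinations of morphisms.
In contrast to `CategoryTheory.Free.lift`, the universes of the two categories are independent. -/
noncomputable def freeLift (F : C ⥤ D) : Free k C ⥤ D where
  obj X := F.obj X
  map {_ _} f := freeLiftHom F f
  map_id _ := ((freeLiftHom_single F (𝟙 _) 1).trans (one_smul _ _)).trans (F.map_id _)
  map_comp f g := freeLiftHom_comp F f g

theorem freeLift_map_embedding (F : C ⥤ D) {X Y : C} (f : X ⟶ Y) :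
    (freeLift F).map ((Free.embedding k C).map f) = F.map f :=
  (freeLiftHom_single F f 1).trans (one_smul _ _)

theorem freeLift_map_add (F : C ⥤ D) {X Y : Free k C} (f g : X ⟶ Y) :
    (freeLift F).map (f + g) = (freeLift F).map f + (freeLift F).map g :=
  map_add (freeLiftHom F) f g

theorem freeLift_map_smul (F : C ⥤ D) {X Y : Free k C} (r : k) (f : X ⟶ Y) :
    (freeLift F).map (r • f) = r • (freeLift F).map f :=
  map_smul (freeLiftHom F) r f

instance (F : C ⥤ D) : (freeLift (k := k) F).Additive :=
  ⟨fun {_ _ f g} => freeLift_map_add F f g⟩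

end FreeLift

variable {k E : Type u} [Field k]

/-- A module over `C_E`, described by its vector spaces `V U` and the maps `φ U W` by which the
shortest paths from `U` to `W` act. Composites of shortest paths which are no shortest paths act
by zero. -/
structure CubeSystem (k E : Type u) [Field k] where
  /-- the vector space at a vertex -/
  V : Vertex E → Type u
  [addCommGroup : ∀ U, AddCommGroup (V U)]
  [module : ∀ U, Module k (V U)]
  /-- the action of the shortest paths between two vertices -/
  φ : ∀ U W, V U →ₗ[k] V W
  φ_self : ∀ U x, φ U U x = x
  φ_comp : ∀ {U W Z}, Disjoint (diff U W) (diff W Z) → ∀ x, φ W Z (φ U W x) = φ U Z x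
  φ_zero : ∀ {U W Z}, ¬ Disjoint (diff U W) (diff W Z) → ∀ x, φ W Z (φ U W x) = 0

attribute [instance] CubeSystem.addCommGroup CubeSystem.module

/-- The system of vector spaces defined by a module over `C_E`. -/
noncomputable def toSystem (F : LinearModuleCat k (PathCat k E)) : CubeSystem k E where
  V U := F.obj.obj (vtx k U)
  φ U W := (F.obj.map (canon k U W)).hom
  φ_self U x := by simp [canon_self]
  φ_comp h x := by
    rw [← canon_comp k h, F.obj.map_comp]
    rfl
  φ_zero {U W Z} h x := by
    have := F.property.1
    have h1 := congrArg (F.obj.map ·) (canon_comp_eq_zero k h)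
    simp only [F.obj.map_comp, F.obj.map_zero] at h1
    exact congr(($h1).hom x)

/-- A family of linear maps compatible with the action of the shortest paths is a morphism of
modules over `C_E`. -/
noncomputable def homOfSystem {F G : LinearModuleCat k (PathCat k E)}
    (h : ∀ U, (toSystem F).V U →ₗ[k] (toSystem G).V U)
    (hh : ∀ U W x, (toSystem G).φ U W (h U x) = h W ((toSystem F).φ U W x)) : F ⟶ G :=
  ObjectProperty.homMk
    { app X := ModuleCat.ofHom (h X.as)
      naturality := by
        have := F.property.1
        have := F.property.2
        have := G.property.1
        have := G.property.2
        have hpath : ∀ {U W : Vertex E} (a : Quiver.Path U W),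
            F.obj.map (pathHom k a) ≫ ModuleCat.ofHom (h W) =
              ModuleCat.ofHom (h U) ≫ G.obj.map (pathHom k a) := by
          intro U W a
          induction a with
          | nil =>
            rw [pathHom_nil, F.obj.map_id, G.obj.map_id]
            exact (Category.id_comp _).trans (Category.comp_id _).symm
          | @cons V W a f ih =>
            have hf : F.obj.map (arr k f) ≫ ModuleCat.ofHom (h W) =
                ModuleCat.ofHom (h V) ≫ G.obj.map (arr k f) := by
              rw [arr_eq_canon]
              ext x
              exact (hh V W x).symm
            rw [pathHom_cons, F.obj.map_comp, G.obj.map_comp, Category.assoc, hf]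
            exact congrArg (· ≫ G.obj.map (arr k f)) ih
        intro X Y f
        induction f using CategoryTheory.Quotient.induction with
        | @h X Y f =>
        induction f using Finsupp.induction_linear with
        | zero =>
          refine Eq.trans (congrArg (F.obj.map · ≫ _) (Functor.map_zero _ _ _)) ?_
          refine Eq.trans ?_ (congrArg (_ ≫ G.obj.map ·) (Functor.map_zero _ _ _).symm)
          rw [Functor.map_zero, Functor.map_zero, Limits.zero_comp, Limits.comp_zero]
        | add f g hf hg =>
          have h1 := (Quotient.functor (Rel k (E := E))).map_add (f := f) (g := g)
          refine Eq.trans (congrArg (F.obj.map · ≫ _) h1) ?_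
          refine Eq.trans ?_ (congrArg (_ ≫ G.obj.map ·) h1.symm)
          rw [Functor.map_add, Functor.map_add, Preadditive.add_comp, Preadditive.comp_add]
          exact congrArg₂ (· + ·) hf hg
        | single a r =>
          have h1 : (Quotient.functor (Rel k (E := E))).map (X := X) (Y := Y)
              (Finsupp.single a r) = r • pathHom k (U := X) (W := Y) a := by
            have h2 : (Finsupp.single a r : (X : FreePath k E) ⟶ Y) =
                r • (Finsupp.single a (1 : k) : (X : FreePath k E) ⟶ Y) :=
              (Finsupp.smul_single_one a r).symm
            rw [h2]
            rfl
          rw [h1]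
          refine Eq.trans (congrArg (· ≫ _) (F.obj.map_smul r (pathHom k (U := X) (W := Y) a))) ?_
          refine Eq.trans ?_
            (congrArg (_ ≫ ·) (G.obj.map_smul r (pathHom k (U := X) (W := Y) a)).symm)
          refine Eq.trans (Linear.smul_comp _ _ _ r _ _) (Eq.trans ?_
            (Linear.comp_smul _ _ _ _ r _).symm)
          exact congrArg (r • ·) (hpath (U := X) (W := Y) a) }

namespace CubeSystem

variable (S : CubeSystem k E)

/-- The functor on the path category of `Q_E` defined by a system of vector spaces. -/
noncomputable def pathFunctor : Paths (Vertex E) ⥤ ModuleCat.{u} k :=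
  Paths.lift { obj U := ModuleCat.of k (S.V U), map {U W} _ := ModuleCat.ofHom (S.φ U W) }

/-- The relations of `C_E` hold in the category of vector spaces: cycles `U → W → U` and squares
are the simplest composites to which `φ_zero` and `φ_comp` apply. -/
theorem freeLift_map_eq_of_rel {X Y : FreePath k E} {f g : X ⟶ Y} (h : Rel k f g) :
    (freeLift S.pathFunctor).map f = (freeLift S.pathFunctor).map g := by
  have harrow : ∀ {U W : Vertex E} (a : U ⟶ W),
      (freeLift S.pathFunctor).map (arrow k a) = ModuleCat.ofHom (S.φ U W) := by
    intro U W a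
    exact (freeLift_map_embedding S.pathFunctor _).trans (Paths.lift_toPath _ _)
  induction h with
  | @cycle U W a b =>
    rw [Functor.map_comp, harrow, harrow, Functor.map_zero]
    ext x
    obtain ⟨e, he⟩ := exists_diff_eq_of_hom a
    exact S.φ_zero (U := U) (W := W) (Z := U) (by rw [diff_comm W U, he]; simp) x
  | @square U W U' W' a b a' b' h =>
    rw [Functor.map_comp, Functor.map_comp, harrow, harrow, harrow, harrow]
    have key : ∀ {V : Vertex E}, (U ⟶ V) → (V ⟶ W') → U ≠ W' →
        Disjoint (diff U V) (diff V W') := by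
      intro V f g hne
      obtain ⟨i, hi⟩ := exists_diff_eq_of_hom f
      obtain ⟨j, hj⟩ := exists_diff_eq_of_hom g
      rw [hi, hj, Set.disjoint_singleton]
      rintro rfl
      exact hne (eq_of_diff_eq (U := V) (by rw [hj, diff_comm, hi]))
    have hne : U ≠ W' := by
      simp only [List.nodup_cons, List.mem_cons] at h
      tauto
    ext x
    exact (S.φ_comp (key a b hne) x).trans (S.φ_comp (key a' b' hne) x).symm
  | refl f => rfl
  | symm _ ih => exact ih.symm
  | trans _ _ ih ih' => exact ih.trans ih'
  | add _ _ ih ih' => rw [freeLift_map_add, freeLift_map_add, ih, ih']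
  | smul c _ ih => rw [freeLift_map_smul, freeLift_map_smul, ih]
  | comp_left f _ ih => rw [Functor.map_comp, Functor.map_comp, ih]
  | comp_right g _ ih => rw [Functor.map_comp, Functor.map_comp, ih]

/-- The module over `C_E` defined by a system of vector spaces. -/
noncomputable def toModule : LinearModuleCat k (PathCat k E) where
  obj := CategoryTheory.Quotient.lift _ (freeLift S.pathFunctor) fun _ _ _ _ h =>
    S.freeLift_map_eq_of_rel h
  property := by
    constructor
    · refine ⟨fun {X Y f g} => ?_⟩
      obtain ⟨f, rfl⟩ := (Quotient.functor (Rel k (E := E))).map_surjective f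
      obtain ⟨g, rfl⟩ := (Quotient.functor (Rel k (E := E))).map_surjective g
      rw [← Functor.map_add]
      exact freeLift_map_add S.pathFunctor f g
    · refine ⟨fun {X Y} f r => ?_⟩
      obtain ⟨f, rfl⟩ := (Quotient.functor (Rel k (E := E))).map_surjective f
      rw [← Functor.map_smul]
      exact freeLift_map_smul S.pathFunctor r f

/-- Passing to a module and back recovers the maps of a system; the vector spaces agree by
definition. -/
theorem toSystem_toModule_φ (U W : Vertex E) (x : S.V U) :
    (toSystem S.toModule).φ U W x = S.φ U W x := by
  have key : ∀ {W : Vertex E} (a : Quiver.Path U W), a.length = (diff U W).ncard →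
      ∀ x : S.V U, (S.pathFunctor.map (X := (Paths.of (Vertex E)).obj U)
        (Y := (Paths.of (Vertex E)).obj W) a).hom x = S.φ U W x := by
    intro W a
    induction a with
    | nil => exact fun _ x => (S.φ_self U x).symm
    | @cons V W a f ih =>
      intro ha x
      rw [Quiver.Path.length_cons] at ha
      have hle := ncard_diff_le_length a
      obtain ⟨e, he⟩ := exists_diff_eq_of_hom f
      have hmem : e ∉ diff U V := fun h1 => by
        have := ncard_diff_step_of_mem he h1
        omega
      have hc := ncard_diff_step_of_notMem he hmem
      have h2 : (S.pathFunctor.map (X := (Paths.of (Vertex E)).obj U)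
          (Y := (Paths.of (Vertex E)).obj W) (a.cons f)) =
          S.pathFunctor.map (X := (Paths.of (Vertex E)).obj U)
          (Y := (Paths.of (Vertex E)).obj V) a ≫
            (ModuleCat.ofHom (S.φ V W) : ModuleCat.of k (S.V V) ⟶ ModuleCat.of k (S.V W)) :=
        Paths.lift_cons _ _ _
      rw [← S.φ_comp (U := U) (W := V) (by rw [he]; simpa using hmem)]
      exact (congr(($h2).hom x)).trans (congrArg (S.φ V W) (ih (by omega) x))
  refine Eq.trans ?_ (key (exists_geodesic U W).choose (exists_geodesic U W).choose_spec x)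
  have h3 := freeLift_map_embedding (k := k) S.pathFunctor (X := (Paths.of (Vertex E)).obj U)
    (Y := (Paths.of (Vertex E)).obj W) (exists_geodesic U W).choose
  exact congr(($h3).hom x)

end CubeSystem

end SubsetQuiver

/-! ### Chambers of the weight lattice -/

namespace Weyl

open SubsetQuiver

section Chambers

variable {k I : Type u} [Field k]

/-- The `i`-th entry of the weight `p + v` is a nonnegative integer. -/
def IsNonnegAt (p : I → k) (v : I →₀ ℤ) (i : I) : Prop := ∃ n : ℕ, p i + (v i : k) = n

theorem isNonnegAt_congr (p : I → k) {v w : I →₀ ℤ} {i : I} (h : v i = w i) :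
    IsNonnegAt p v i ↔ IsNonnegAt p w i := by
  rw [IsNonnegAt, IsNonnegAt, h]

theorem IsNonnegAt.mono {p : I → k} {v w : I →₀ ℤ} {i : I} (h : IsNonnegAt p v i)
    (hvw : v i ≤ w i) : IsNonnegAt p w i := by
  obtain ⟨n, hn⟩ := h
  obtain ⟨m, hm⟩ := Int.le.dest hvw
  refine ⟨n + m, ?_⟩
  rw [← hm, Int.cast_add, ← add_assoc, hn]
  push_cast
  rfl

theorem chamber_finite (p : I → k) (v : I →₀ ℤ) :
    {i : integralSet p | ¬ (IsNonnegAt p v i ↔ IsNonnegAt p 0 i)}.Finite := by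
  refine Set.Finite.subset (v.support.finite_toSet.preimage Subtype.val_injective.injOn) ?_
  intro i hi
  by_contra h
  exact hi (isNonnegAt_congr p (by simpa using h))

/-- The vertex of `Q_J`, `J = J_p`, which records at which `i ∈ J` the weights `p + v` and `p` lie
on different sides of the wall between `-1` and `0`. -/
noncomputable def chamber (p : I → k) (v : I →₀ ℤ) : Vertex (integralSet p) :=
  ⟨(chamber_finite p v).toFinset⟩

theorem mem_diff_chamber {p : I → k} {v w : I →₀ ℤ} {i : integralSet p} :
    i ∈ diff (chamber p v) (chamber p w) ↔ ¬ (IsNonnegAt p v i ↔ IsNonnegAt p w i) := by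
  simp only [mem_diff, chamber, Set.Finite.mem_toFinset, Set.mem_ofPred_eq]
  tauto

/-- If `w` lies between `v` and `z`, then no wall is crossed twice. -/
theorem disjoint_diff_chamber (p : I → k) {v w z : I →₀ ℤ}
    (h : ∀ i, (v i ≤ w i ∧ w i ≤ z i) ∨ (z i ≤ w i ∧ w i ≤ v i)) :
    Disjoint (diff (chamber p v) (chamber p w)) (diff (chamber p w) (chamber p z)) := by
  rw [Set.disjoint_left]
  intro i h1 h2
  rw [mem_diff_chamber] at h1 h2
  rcases h i with ⟨h3, h4⟩ | ⟨h3, h4⟩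
  · have h5 : IsNonnegAt p v i → IsNonnegAt p w i := fun h => h.mono h3
    have h6 : IsNonnegAt p w i → IsNonnegAt p z i := fun h => h.mono h4
    tauto
  · have h5 : IsNonnegAt p z i → IsNonnegAt p w i := fun h => h.mono h3
    have h6 : IsNonnegAt p w i → IsNonnegAt p v i := fun h => h.mono h4
    tauto

theorem mem_integralSet_of_eq_zero {p : I → k} {v : I →₀ ℤ} {i : I} (h : p i + (v i : k) = 0) :
    i ∈ integralSet p :=
  ⟨-v i, by rw [Int.cast_neg, eq_neg_iff_add_eq_zero, h]⟩

theorem chamber_sub_single {p : I → k} {v : I →₀ ℤ} {i : I} (h : p i + (v i : k) ≠ 0) :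
    chamber p (v - Finsupp.single i 1) = chamber p v := by
  refine eq_of_diff_eq_empty (Set.eq_empty_iff_forall_notMem.2 fun j hj => ?_)
  rw [mem_diff_chamber] at hj
  by_cases hij : (j : I) = i
  · refine hj ⟨fun h1 => h1.mono (by rw [Finsupp.sub_apply, hij]; simp), ?_⟩
    rintro ⟨n, hn⟩
    rw [hij] at hn ⊢
    cases n with
    | zero => exact absurd (by simpa using hn) h
    | succ n =>
      refine ⟨n, ?_⟩
      rw [Finsupp.sub_apply, Finsupp.single_eq_same, Int.cast_sub, ← add_sub_assoc, hn]
      simp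
  · refine hj (isNonnegAt_congr p ?_)
    rw [Finsupp.sub_apply, Finsupp.single_eq_of_ne hij, sub_zero]

variable [CharZero k]

theorem isNonnegAt_of_eq_zero {p : I → k} {v : I →₀ ℤ} {i : I} (h : p i + (v i : k) = 0) :
    IsNonnegAt p v i ∧ ¬ IsNonnegAt p (v - Finsupp.single i 1) i := by
  refine ⟨⟨0, by simpa using h⟩, ?_⟩
  rintro ⟨n, hn⟩
  rw [Finsupp.sub_apply, Finsupp.single_eq_same, Int.cast_sub, ← add_sub_assoc, h, zero_sub,
    Int.cast_one, neg_eq_iff_add_eq_zero] at hn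
  exact absurd hn (by rw [add_comm]; exact Nat.cast_add_one_ne_zero n)

/-- The step from `v - e_i` to `v` crosses a wall exactly when the `i`-th entry of `p + v` is
zero. -/
theorem mem_diff_chamber_sub_single {p : I → k} {v : I →₀ ℤ} {i : I} (h : p i + (v i : k) = 0) :
    (⟨i, mem_integralSet_of_eq_zero h⟩ : integralSet p) ∈
      diff (chamber p (v - Finsupp.single i 1)) (chamber p v) := by
  rw [mem_diff_chamber]
  have := isNonnegAt_of_eq_zero h
  tauto

/-- Stepping over a wall and back again is not a shortest path. -/
theorem not_disjoint_sub_single {p : I → k} {v : I →₀ ℤ} {i : I} (h : p i + (v i : k) = 0) :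
    ¬ Disjoint (diff (chamber p v) (chamber p (v - Finsupp.single i 1)))
      (diff (chamber p (v - Finsupp.single i 1)) (chamber p v)) := by
  rw [diff_comm (chamber p v), disjoint_self]
  exact Set.Nonempty.ne_empty ⟨_, mem_diff_chamber_sub_single h⟩

theorem not_disjoint_sub_single' {p : I → k} {v : I →₀ ℤ} {i : I} (h : p i + (v i : k) = 0) :
    ¬ Disjoint (diff (chamber p (v - Finsupp.single i 1)) (chamber p v))
      (diff (chamber p v) (chamber p (v - Finsupp.single i 1))) := by
  rw [disjoint_comm]
  exact not_disjoint_sub_single h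

/-- An integer entry can be moved to the other side of the wall. -/
theorem exists_isNonnegAt_single_iff (p : I → k) (i : integralSet p) :
    ∃ m : ℤ, ¬ (IsNonnegAt p (Finsupp.single (i : I) m) i ↔ IsNonnegAt p 0 i) := by
  obtain ⟨n, hn⟩ := i.2
  by_cases h : IsNonnegAt p 0 i
  · refine ⟨-n - 1, ?_⟩
    have h1 : ¬ IsNonnegAt p (Finsupp.single (i : I) (-n - 1)) i := by
      rintro ⟨m, hm⟩
      rw [hn, Finsupp.single_eq_same, ← Int.cast_add, ← Int.cast_natCast, Int.cast_inj] at hm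
      omega
    tauto
  · refine ⟨-n, ?_⟩
    have h1 : IsNonnegAt p (Finsupp.single (i : I) (-n)) i :=
      ⟨0, by rw [hn, Finsupp.single_eq_same, ← Int.cast_add]; simp⟩
    tauto

theorem chamber_surjective (p : I → k) : Function.Surjective (chamber p) := by
  classical
  intro U
  choose m hm using exists_isNonnegAt_single_iff p
  let v : I →₀ ℤ := Finsupp.embDomain (Function.Embedding.subtype _)
    (Finsupp.indicator U.carrier fun i _ => m i)
  have hv : ∀ i : integralSet p, v i = if i ∈ U.carrier then m i else 0 := by
    intro i
    refine (Finsupp.embDomain_apply_self (Function.Embedding.subtype _) _ i).trans ?_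
    rw [Finsupp.indicator_apply]
    split_ifs <;> rfl
  refine ⟨v, ?_⟩
  have h : ∀ i : integralSet p, i ∈ (chamber p v).carrier ↔ i ∈ U.carrier := by
    intro i
    simp only [chamber, Set.Finite.mem_toFinset, Set.mem_ofPred_eq]
    have h1 := hv i
    split_ifs at h1 with hi
    · rw [isNonnegAt_congr p (w := Finsupp.single (i : I) (m i)) (by rw [h1]; simp)]
      simp [hi, hm i]
    · rw [isNonnegAt_congr p (w := 0) h1]
      simp [hi]
  refine eq_of_diff_eq_empty (Set.eq_empty_iff_forall_notMem.2 fun i hi => ?_)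
  exact mem_diff.1 hi (h i)

/-- A weight in each chamber. -/
noncomputable def chamberPoint (p : I → k) (U : Vertex (integralSet p)) : I →₀ ℤ :=
  (chamber_surjective p U).choose

theorem chamber_chamberPoint (p : I → k) (U : Vertex (integralSet p)) :
    chamber p (chamberPoint p U) = U :=
  (chamber_surjective p U).choose_spec

end Chambers

/-! ### The weight module of a system of vector spaces -/

section Model

variable {k I : Type u} [Field k] (p : I → k) (S : CubeSystem k (integralSet p))

/-- The sum of one copy of `V U` for each weight in the chamber `U`. -/
def Model : Type u := DirectSum (I →₀ ℤ) fun v => S.V (chamber p v)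

namespace Model

noncomputable instance : AddCommGroup (Model p S) :=
  inferInstanceAs (AddCommGroup (DirectSum (I →₀ ℤ) fun v => S.V (chamber p v)))

noncomputable instance : Module k (Model p S) :=
  inferInstanceAs (Module k (DirectSum (I →₀ ℤ) fun v => S.V (chamber p v)))

open scoped Classical in
/-- The inclusion of the summand of weight `p + v`. -/
noncomputable def of (v : I →₀ ℤ) : S.V (chamber p v) →ₗ[k] Model p S :=
  DirectSum.lof k (I →₀ ℤ) (fun v => S.V (chamber p v)) v

open scoped Classical in
/-- The linear map defined by its restrictions to the summands. -/
noncomputable def desc {N : Type*} [AddCommGroup N] [Module k N]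
    (f : ∀ v, S.V (chamber p v) →ₗ[k] N) : Model p S →ₗ[k] N :=
  DirectSum.toModule k (I →₀ ℤ) N f

/-- The projection to the summand of weight `p + v`. -/
noncomputable def component (v : I →₀ ℤ) : Model p S →ₗ[k] S.V (chamber p v) :=
  DirectSum.component k (I →₀ ℤ) (fun v => S.V (chamber p v)) v

variable {p S}

theorem desc_of {N : Type*} [AddCommGroup N] [Module k N]
    (f : ∀ v, S.V (chamber p v) →ₗ[k] N) (v : I →₀ ℤ) (a : S.V (chamber p v)) :
    desc p S f (of p S v a) = f v a := by
  classical
  exact DirectSum.toModule_lof (M := fun v => S.V (chamber p v)) k v a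

open scoped Classical in
theorem hom_ext {N : Type*} [AddCommGroup N] [Module k N] {f g : Model p S →ₗ[k] N}
    (h : ∀ v a, f (of p S v a) = g (of p S v a)) : f = g :=
  DirectSum.linearMap_ext (M := fun v => S.V (chamber p v)) k fun v => LinearMap.ext (h v)

theorem component_of_self (v : I →₀ ℤ) (a : S.V (chamber p v)) :
    component p S v (of p S v a) = a := by
  classical
  exact DirectSum.component.lof_self (M := fun v => S.V (chamber p v)) k v a

theorem component_of_ne {v w : I →₀ ℤ} (h : v ≠ w) (a : S.V (chamber p v)) :
    component p S w (of p S v a) = 0 := by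
  classical
  exact DFinsupp.single_eq_of_ne h.symm

theorem ext_component {x y : Model p S} (h : ∀ v, component p S v x = component p S v y) :
    x = y :=
  DFinsupp.ext h

theorem of_injective (v : I →₀ ℤ) : Function.Injective (of p S v) :=
  Function.LeftInverse.injective (component_of_self v)

theorem of_φ_congr {v w w' : I →₀ ℤ} (h : w = w') (a : S.V (chamber p v)) :
    of p S w (S.φ (chamber p v) (chamber p w) a) =
      of p S w' (S.φ (chamber p v) (chamber p w') a) := by
  rw [h]

theorem of_φ_φ {v w z : I →₀ ℤ} (h : ∀ i, (v i ≤ w i ∧ w i ≤ z i) ∨ (z i ≤ w i ∧ w i ≤ v i))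
    (a : S.V (chamber p v)) :
    of p S z (S.φ (chamber p w) (chamber p z) (S.φ (chamber p v) (chamber p w) a)) =
      of p S z (S.φ (chamber p v) (chamber p z) a) := by
  rw [S.φ_comp (disjoint_diff_chamber p h)]

theorem of_φ_self {v w : I →₀ ℤ} (h : w = v) (a : S.V (chamber p v)) :
    of p S w (S.φ (chamber p v) (chamber p w) a) = of p S v a := by
  rw [h, S.φ_self]

variable (p S)

/-- The operator by which `X i` acts. -/
noncomputable def xOp (i : I) : Module.End k (Model p S) :=
  desc p S fun v => of p S (v + Finsupp.single i 1) ∘ₗ S.φ _ _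

open scoped Classical in
/-- The factor by which `Y i` differs from the action of paths on the weight space of `p + v`. -/
noncomputable def yFactor {k I : Type u} [Field k] (p : I → k) (i : I) (v : I →₀ ℤ) : k :=
  if p i + (v i : k) = 0 then 1 else p i + (v i : k)

/-- The operator by which `Y i` acts. -/
noncomputable def yOp (i : I) : Module.End k (Model p S) :=
  desc p S fun v => yFactor p i v • of p S (v - Finsupp.single i 1) ∘ₗ S.φ _ _

variable {p S}

theorem yFactor_of_eq_zero {i : I} {v : I →₀ ℤ} (h : p i + (v i : k) = 0) : yFactor p i v = 1 :=
  if_pos h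

theorem yFactor_of_ne_zero {i : I} {v : I →₀ ℤ} (h : p i + (v i : k) ≠ 0) :
    yFactor p i v = p i + (v i : k) :=
  if_neg h

theorem yFactor_congr {i : I} {v w : I →₀ ℤ} (h : v i = w i) : yFactor p i v = yFactor p i w := by
  rw [yFactor, yFactor, h]

theorem yFactor_ne_zero (i : I) (v : I →₀ ℤ) : yFactor p i v ≠ 0 := by
  by_cases h : p i + (v i : k) = 0
  · rw [yFactor_of_eq_zero h]
    exact one_ne_zero
  · rwa [yFactor_of_ne_zero h]

theorem xOp_of (i : I) (v : I →₀ ℤ) (a : S.V (chamber p v)) :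
    xOp p S i (of p S v a) = of p S (v + Finsupp.single i 1) (S.φ _ _ a) :=
  desc_of _ v a

theorem yOp_of (i : I) (v : I →₀ ℤ) (a : S.V (chamber p v)) :
    yOp p S i (of p S v a) = yFactor p i v • of p S (v - Finsupp.single i 1) (S.φ _ _ a) :=
  desc_of _ v a

theorem between_of_ne {i j : I} (h : i ≠ j) (v : I →₀ ℤ) (m n : ℤ) (l : I) :
    (v l ≤ (v + Finsupp.single i m) l ∧
      (v + Finsupp.single i m) l ≤ (v + Finsupp.single i m + Finsupp.single j n) l) ∨
    ((v + Finsupp.single i m + Finsupp.single j n) l ≤ (v + Finsupp.single i m) l ∧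
      (v + Finsupp.single i m) l ≤ v l) := by
  simp only [Finsupp.add_apply]
  by_cases hi : l = i
  · have hj : l ≠ j := fun hj => h (hi.symm.trans hj)
    rw [Finsupp.single_eq_of_ne hj]
    omega
  · rw [Finsupp.single_eq_of_ne hi]
    omega

theorem xOp_yOp_of [CharZero k] (i : I) (v : I →₀ ℤ) (a : S.V (chamber p v)) :
    xOp p S i (yOp p S i (of p S v a)) = (p i + (v i : k)) • of p S v a := by
  rw [yOp_of, map_smul, xOp_of]
  have hv : v - Finsupp.single i 1 + Finsupp.single i 1 = v := sub_add_cancel _ _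
  by_cases h : p i + (v i : k) = 0
  · rw [h, zero_smul, S.φ_zero, map_zero, smul_zero]
    rw [hv]
    exact not_disjoint_sub_single h
  · rw [yFactor_of_ne_zero h, S.φ_comp, of_φ_self hv]
    rw [chamber_sub_single h, diff_self]
    exact Set.empty_disjoint _

theorem yOp_xOp_of [CharZero k] (i : I) (v : I →₀ ℤ) (a : S.V (chamber p v)) :
    yOp p S i (xOp p S i (of p S v a)) = (p i + (v i : k) + 1) • of p S v a := by
  rw [xOp_of, yOp_of]
  have hv : v + Finsupp.single i 1 - Finsupp.single i 1 = v := add_sub_cancel_right _ _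
  have hw : p i + (((v + Finsupp.single i 1 : I →₀ ℤ) i : ℤ) : k) = p i + (v i : k) + 1 := by
    rw [Finsupp.add_apply, Finsupp.single_eq_same, Int.cast_add, Int.cast_one, add_assoc]
  by_cases h : p i + (v i : k) + 1 = 0
  · rw [h, zero_smul, S.φ_zero, map_zero, smul_zero]
    have := not_disjoint_sub_single' (hw.trans h)
    rwa [hv] at this ⊢
  · have h' := h
    rw [← hw] at h'
    rw [yFactor_of_ne_zero h', hw, S.φ_comp, of_φ_self hv]
    have := chamber_sub_single h'
    rw [this, diff_self]
    exact Set.disjoint_empty _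

theorem weylRelations_model [CharZero k] : WeylRelations (xOp p S) (yOp p S) where
  xx i j := by
    by_cases hij : i = j
    · rw [hij]
    refine hom_ext fun v a => ?_
    simp only [Module.End.mul_apply]
    rw [xOp_of, xOp_of, xOp_of, xOp_of, of_φ_φ (between_of_ne (Ne.symm hij) v 1 1),
      of_φ_φ (between_of_ne hij v 1 1)]
    exact of_φ_congr (add_right_comm _ _ _) a
  yy i j := by
    by_cases hij : i = j
    · rw [hij]
    refine hom_ext fun v a => ?_
    have hb : ∀ {i j : I}, i ≠ j → yOp p S j (yOp p S i (of p S v a)) =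
        (yFactor p i v * yFactor p j v) • of p S (v - Finsupp.single i 1 - Finsupp.single j 1)
          (S.φ (chamber p v) _ a) := by
      intro i j hij
      have h := between_of_ne hij v (-1) (-1)
      simp only [Finsupp.single_neg, ← sub_eq_add_neg] at h
      rw [yOp_of, map_smul, yOp_of, of_φ_φ h, smul_smul]
      congr 2
      refine yFactor_congr ?_
      rw [Finsupp.sub_apply, Finsupp.single_eq_of_ne hij.symm, sub_zero]
    simp only [Module.End.mul_apply]
    rw [hb (Ne.symm hij), hb hij, mul_comm]
    exact congrArg _ (of_φ_congr (sub_right_comm _ _ _) a)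
  yx_ne i j hij := by
    refine hom_ext fun v a => ?_
    simp only [Module.End.mul_apply]
    have h1 := between_of_ne (Ne.symm hij) v 1 (-1)
    have h2 := between_of_ne hij v (-1) 1
    simp only [Finsupp.single_neg, ← sub_eq_add_neg] at h1 h2
    rw [xOp_of, yOp_of, yOp_of, map_smul, xOp_of, of_φ_φ h1, of_φ_φ h2,
      of_φ_congr (sub_add_eq_add_sub v (Finsupp.single i 1) (Finsupp.single j 1))]
    congr 1
    refine yFactor_congr ?_
    rw [Finsupp.add_apply, Finsupp.single_eq_of_ne hij, add_zero]
  yx_self i := by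
    refine hom_ext fun v a => ?_
    simp only [Module.End.mul_apply, LinearMap.add_apply, Module.End.one_apply]
    rw [xOp_yOp_of, yOp_xOp_of, add_smul _ (1 : k), one_smul]

variable [CharZero k]

variable (p S) in
/-- The action of the Weyl algebra. -/
noncomputable def rep : WeylAlgebra k I →ₐ[k] Module.End k (Model p S) :=
  (exists_representation (weylRelations_model (p := p) (S := S))).choose

noncomputable instance : Module (WeylAlgebra k I) (Model p S) :=
  Module.compHom (Model p S) (rep p S).toRingHom

theorem smul_def (a : WeylAlgebra k I) (x : Model p S) : a • x = rep p S a x := rfl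

instance : IsScalarTower k (WeylAlgebra k I) (Model p S) :=
  ⟨fun c a x => by rw [smul_def, map_smul]; rfl⟩

theorem genX_smul (i : I) (x : Model p S) : genX k i • x = xOp p S i x := by
  exact DFunLike.congr_fun ((exists_representation weylRelations_model).choose_spec.1 i) x

theorem genY_smul (i : I) (x : Model p S) : genY k i • x = yOp p S i x := by
  exact DFunLike.congr_fun ((exists_representation weylRelations_model).choose_spec.2 i) x

theorem genT_smul_of (i : I) (v : I →₀ ℤ) (a : S.V (chamber p v)) :
    genT k i • of p S v a = (p i + (v i : k)) • of p S v a := by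
  rw [genT, mul_smul, genX_smul, genY_smul, xOp_yOp_of]

theorem of_mem_latticeWeightSpace (v : I →₀ ℤ) (a : S.V (chamber p v)) :
    of p S v a ∈ latticeWeightSpace p (Model p S) v :=
  fun i => genT_smul_of i v a

variable (p S) in
theorem iSup_latticeWeightSpace : ⨆ v, latticeWeightSpace p (Model p S) v = ⊤ := by
  rw [← Submodule.ker_mkQ (⨆ v, latticeWeightSpace p (Model p S) v), LinearMap.ker_eq_top]
  refine hom_ext fun v a => ?_
  rw [LinearMap.zero_apply, Submodule.mkQ_apply, Submodule.Quotient.mk_eq_zero]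
  exact Submodule.mem_iSup_of_mem v (of_mem_latticeWeightSpace v a)

theorem mem_range_of_of_mem {v : I →₀ ℤ} {x : Model p S}
    (hx : x ∈ latticeWeightSpace p (Model p S) v) : of p S v (component p S v x) = x := by
  refine ext_component fun w => ?_
  by_cases h : v = w
  · subst h
    rw [component_of_self]
  · rw [component_of_ne h]
    obtain ⟨i, hi⟩ := Function.ne_iff.1 ((latticeWeight_injective p).ne h)
    have hc : ∀ y : Model p S, component p S w (genT k i • y) =
        (p i + (w i : k)) • component p S w y := by
      intro y
      let t : Module.End k (Model p S) := rep p S (genT k i)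
      have : component p S w ∘ₗ t = (p i + (w i : k)) • component p S w := by
        refine hom_ext fun z a => ?_
        change component p S w (genT k i • of p S z a) = (p i + (w i : k)) • _
        rw [genT_smul_of, map_smul]
        by_cases hz : z = w
        · subst hz
          rfl
        · rw [component_of_ne hz, smul_zero, smul_zero]
      exact DFunLike.congr_fun this y
    have h1 := hc x
    rw [hx i, map_smul, ← sub_eq_zero, ← sub_smul] at h1
    exact ((smul_eq_zero.1 h1).resolve_left (sub_ne_zero.2 hi)).symm

end Model

end Model

end Weyl

/-! ### The functor from `C_J`-modules to weight modules -/

namespace Weyl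

open SubsetQuiver

/-- Induction along shortest paths from the origin in the lattice of finitely supported integral
vectors. -/
theorem lattice_induction {I : Type*} {P : (I →₀ ℤ) → Prop} (zero : P 0)
    (add : ∀ u i, 0 ≤ u i → P u → P (u + Finsupp.single i 1))
    (sub : ∀ u i, u i ≤ 0 → P u → P (u - Finsupp.single i 1)) (u : I →₀ ℤ) : P u := by
  induction u using Finsupp.induction with
  | zero => exact zero
  | single_add i b f hi hb ih =>
    clear hb
    have hf : f i = 0 := Finsupp.notMem_support_iff.1 hi
    induction b with
    | zero => simpa using ih
    | succ n hn =>
      have := add (Finsupp.single i (n : ℤ) + f) i (by simp [hf]) hn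
      rwa [add_right_comm, ← Finsupp.single_add] at this
    | pred n hn =>
      have := sub (Finsupp.single i (-n : ℤ) + f) i (by simp [hf]) hn
      rwa [add_sub_right_comm, ← Finsupp.single_sub] at this

section

variable {k I : Type u} [Field k]

/-- A `k`-linear map which commutes with the generators of the Weyl algebra commutes with all its
elements. -/
theorem map_smul_of_gen {M N : Type*} [AddCommGroup M] [Module k M] [Module (WeylAlgebra k I) M]
    [IsScalarTower k (WeylAlgebra k I) M] [AddCommGroup N] [Module k N]
    [Module (WeylAlgebra k I) N] [IsScalarTower k (WeylAlgebra k I) N] (f : M →ₗ[k] N)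
    (hX : ∀ (i : I) x, f (genX k i • x) = genX k i • f x)
    (hY : ∀ (i : I) x, f (genY k i • x) = genY k i • f x) (a : WeylAlgebra k I) (x : M) :
    f (a • x) = a • f x := by
  obtain ⟨a, ha⟩ := a
  induction ha using Algebra.adjoin_induction generalizing x with
  | mem a ha =>
    rcases ha with ⟨i, rfl⟩ | ⟨i, rfl⟩
    · exact hX i x
    · exact hY i x
  | algebraMap c =>
    change f (algebraMap k (WeylAlgebra k I) c • x) = algebraMap k (WeylAlgebra k I) c • f x
    rw [algebraMap_smul, algebraMap_smul, map_smul]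
  | add a b ha hb iha ihb =>
    change f (((⟨a, ha⟩ : WeylAlgebra k I) + ⟨b, hb⟩) • x) =
      ((⟨a, ha⟩ : WeylAlgebra k I) + ⟨b, hb⟩) • f x
    rw [add_smul, add_smul, map_add, iha, ihb]
  | mul a b ha hb iha ihb =>
    change f (((⟨a, ha⟩ : WeylAlgebra k I) * ⟨b, hb⟩) • x) =
      ((⟨a, ha⟩ : WeylAlgebra k I) * ⟨b, hb⟩) • f x
    rw [mul_smul, mul_smul, iha, ihb]

/-- A `k`-linear map which commutes with the generators of the Weyl algebra, as a linear map over
the Weyl algebra. -/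
def linearMapOfGen {M N : Type*} [AddCommGroup M] [Module k M] [Module (WeylAlgebra k I) M]
    [IsScalarTower k (WeylAlgebra k I) M] [AddCommGroup N] [Module k N]
    [Module (WeylAlgebra k I) N] [IsScalarTower k (WeylAlgebra k I) N] (f : M →ₗ[k] N)
    (hX : ∀ (i : I) x, f (genX k i • x) = genX k i • f x)
    (hY : ∀ (i : I) x, f (genY k i • x) = genY k i • f x) : M →ₗ[WeylAlgebra k I] N where
  toFun := f
  map_add' := map_add f
  map_smul' := map_smul_of_gen f hX hY

namespace Model

variable [CharZero k] {p : I → k} {S S' : CubeSystem k (integralSet p)}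

theorem between_add {I : Type*} (v u : I →₀ ℤ) (i : I) (hu : 0 ≤ u i) (l : I) :
    (v l ≤ (v + u) l ∧ (v + u) l ≤ (v + u + Finsupp.single i 1 : I →₀ ℤ) l) ∨
      ((v + u + Finsupp.single i 1 : I →₀ ℤ) l ≤ (v + u) l ∧ (v + u) l ≤ v l) := by
  by_cases hl : l = i
  · subst hl
    simp [hu]
  · simp only [Finsupp.add_apply, Finsupp.single_eq_of_ne hl]
    omega

theorem between_sub {I : Type*} (v u : I →₀ ℤ) (i : I) (hu : u i ≤ 0) (l : I) :
    (v l ≤ (v + u) l ∧ (v + u) l ≤ (v + u - Finsupp.single i 1 : I →₀ ℤ) l) ∨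
      ((v + u - Finsupp.single i 1 : I →₀ ℤ) l ≤ (v + u) l ∧ (v + u) l ≤ v l) := by
  by_cases hl : l = i
  · subst hl
    simp [hu]
  · simp only [Finsupp.add_apply, Finsupp.sub_apply, Finsupp.single_eq_of_ne hl]
    omega

theorem smul_hom_ext {N : Type*} [AddCommGroup N] [Module k N] [Module (WeylAlgebra k I) N]
    [IsScalarTower k (WeylAlgebra k I) N] {f g : Model p S →ₗ[WeylAlgebra k I] N}
    (h : ∀ v a, f (of p S v a) = g (of p S v a)) : f = g := by
  have : f.restrictScalars k = g.restrictScalars k := hom_ext h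
  exact LinearMap.ext fun x => DFunLike.congr_fun this x

/-- To give a linear map on the weight module of a system, it suffices to give linear maps on the
weight spaces which are compatible with the generators of the Weyl algebra. -/
noncomputable def descOfGen {N : Type*} [AddCommGroup N] [Module k N] [Module (WeylAlgebra k I) N]
    [IsScalarTower k (WeylAlgebra k I) N] (f : ∀ v, S.V (chamber p v) →ₗ[k] N)
    (hX : ∀ i v a, f (v + Finsupp.single i 1) (S.φ _ _ a) = genX k i • f v a)
    (hY : ∀ i v a, yFactor p i v • f (v - Finsupp.single i 1) (S.φ _ _ a) = genY k i • f v a) :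
    Model p S →ₗ[WeylAlgebra k I] N :=
  linearMapOfGen (desc p S f)
    (fun i x => by
      have : desc p S f ∘ₗ xOp p S i =
          DistribSMul.toLinearMap k N (genX k i) ∘ₗ desc p S f := by
        refine hom_ext fun v a => ?_
        simp only [LinearMap.comp_apply, DistribSMul.toLinearMap_apply]
        rw [xOp_of, desc_of, desc_of, hX]
      rw [genX_smul]
      exact DFunLike.congr_fun this x)
    (fun i x => by
      have : desc p S f ∘ₗ yOp p S i =
          DistribSMul.toLinearMap k N (genY k i) ∘ₗ desc p S f := by
        refine hom_ext fun v a => ?_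
        simp only [LinearMap.comp_apply, DistribSMul.toLinearMap_apply]
        rw [yOp_of, map_smul, desc_of, desc_of, hY]
      rw [genY_smul]
      exact DFunLike.congr_fun this x)

theorem descOfGen_of {N : Type*} [AddCommGroup N] [Module k N] [Module (WeylAlgebra k I) N]
    [IsScalarTower k (WeylAlgebra k I) N] (f : ∀ v, S.V (chamber p v) →ₗ[k] N)
    (hX : ∀ i v a, f (v + Finsupp.single i 1) (S.φ _ _ a) = genX k i • f v a)
    (hY : ∀ i v a, yFactor p i v • f (v - Finsupp.single i 1) (S.φ _ _ a) = genY k i • f v a)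
    (v : I →₀ ℤ) (a : S.V (chamber p v)) : descOfGen f hX hY (of p S v a) = f v a :=
  desc_of f v a

/-- The linear map between weight modules defined by a morphism of systems. -/
noncomputable def map (h : ∀ U, S.V U →ₗ[k] S'.V U)
    (hh : ∀ U W x, S'.φ U W (h U x) = h W (S.φ U W x)) :
    Model p S →ₗ[WeylAlgebra k I] Model p S' :=
  descOfGen (fun v => of p S' v ∘ₗ h _)
    (fun i v a => by
      rw [LinearMap.comp_apply, LinearMap.comp_apply, genX_smul, xOp_of, hh])
    (fun i v a => by
      rw [LinearMap.comp_apply, LinearMap.comp_apply, genY_smul, yOp_of, hh])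

theorem map_of (h : ∀ U, S.V U →ₗ[k] S'.V U)
    (hh : ∀ U W x, S'.φ U W (h U x) = h W (S.φ U W x)) (v : I →₀ ℤ) (a : S.V (chamber p v)) :
    map h hh (of p S v a) = of p S' v (h _ a) :=
  descOfGen_of _ _ _ v a

theorem eq_of_map_eq {h h' : ∀ U, S.V U →ₗ[k] S'.V U}
    {hh : ∀ U W x, S'.φ U W (h U x) = h W (S.φ U W x)}
    {hh' : ∀ U W x, S'.φ U W (h' U x) = h' W (S.φ U W x)}
    (e : map (p := p) h hh = map h' hh') : h = h' := by
  funext U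
  obtain ⟨v, rfl⟩ := chamber_surjective p U
  ext a
  have := DFunLike.congr_fun e (of p S v a)
  rw [map_of, map_of] at this
  exact of_injective v this

/-- A homomorphism of weight modules preserves weights, and its components commute with the
action of shortest paths. Hence it comes from a morphism of systems. -/
theorem exists_map_eq (g : Model p S →ₗ[WeylAlgebra k I] Model p S') :
    ∃ h hh, map (p := p) (S := S) (S' := S') h hh = g := by
  let c : ∀ v, S.V (chamber p v) →ₗ[k] S'.V (chamber p v) := fun v =>
    component p S' v ∘ₗ g.restrictScalars k ∘ₗ of p S v
  have hc : ∀ v a, g (of p S v a) = of p S' v (c v a) := by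
    intro v a
    refine (mem_range_of_of_mem fun i => ?_).symm
    rw [← map_smul, genT_smul_of, LinearMap.map_smul_of_tower]
  have hX : ∀ i v a, S'.φ (chamber p v) (chamber p (v + Finsupp.single i 1)) (c v a) =
      c (v + Finsupp.single i 1) (S.φ _ _ a) := by
    intro i v a
    apply of_injective (v + Finsupp.single i 1)
    rw [← hc, ← xOp_of, ← xOp_of, ← hc, ← genX_smul, ← genX_smul, map_smul]
  have hY : ∀ i v a, S'.φ (chamber p v) (chamber p (v - Finsupp.single i 1)) (c v a) =
      c (v - Finsupp.single i 1) (S.φ _ _ a) := by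
    intro i v a
    apply of_injective (v - Finsupp.single i 1)
    apply smul_right_injective _ (yFactor_ne_zero (p := p) i v)
    dsimp only
    rw [← hc, ← LinearMap.map_smul_of_tower g, ← yOp_of, ← yOp_of, ← hc, ← genY_smul, ← genY_smul,
      map_smul]
  have key : ∀ (v u : I →₀ ℤ), ∀ w, w = v + u → ∀ a,
      S'.φ (chamber p v) (chamber p w) (c v a) = c w (S.φ _ _ a) := by
    intro v u
    induction u using lattice_induction with
    | zero =>
      rintro w rfl a
      rw [add_zero, S.φ_self, S'.φ_self]
    | add u i hu ih =>
      rintro w rfl a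
      have hd := disjoint_diff_chamber p (v := v) (w := v + u) (z := v + u + Finsupp.single i 1)
        (between_add v u i hu)
      rw [← add_assoc, ← S.φ_comp hd, ← S'.φ_comp hd, ih _ rfl, hX]
    | sub u i hu ih =>
      rintro w rfl a
      have hd := disjoint_diff_chamber p (v := v) (w := v + u) (z := v + u - Finsupp.single i 1)
        (between_sub v u i hu)
      rw [← add_sub_assoc, ← S.φ_comp hd, ← S'.φ_comp hd, ih _ rfl, hY]
  replace key : ∀ v w a, S'.φ (chamber p v) (chamber p w) (c v a) = c w (S.φ _ _ a) :=
    fun v w => key v (w - v) w (add_sub_cancel v w).symm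
  -- The component at a vertex `U` is the one at a chosen weight in the chamber `U`.
  have hU := fun U => chamber_chamberPoint p U
  refine ⟨fun U => S'.φ (chamber p (chamberPoint p U)) U ∘ₗ c (chamberPoint p U) ∘ₗ
    S.φ U (chamber p (chamberPoint p U)), fun U W x => ?_, ?_⟩
  · simp only [LinearMap.comp_apply]
    rw [S.φ_comp (disjoint_diff_of_eq_right (hU W).symm _),
      ← S.φ_comp (disjoint_diff_of_eq_left (hU U).symm (chamber p (chamberPoint p W))),
      ← key (chamberPoint p U) (chamberPoint p W),
      S'.φ_comp (disjoint_diff_of_eq_left (hU U) _), S'.φ_comp (disjoint_diff_of_eq_right (hU W) _)]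
  · refine smul_hom_ext fun v a => ?_
    rw [map_of, hc]
    simp only [LinearMap.comp_apply]
    rw [key, S.φ_comp (disjoint_diff_of_eq_left (hU _).symm _), S.φ_self]

end Model

variable [CharZero k] (p : I → k)

/-- The linear map between the vector spaces at a vertex defined by a morphism of `C_J`-modules. -/
noncomputable def systemHom {F G : LinearModuleCat k (PathCat k (integralSet p))} (f : F ⟶ G)
    (U : Vertex (integralSet p)) : (toSystem F).V U →ₗ[k] (toSystem G).V U :=
  (f.hom.app (vtx k U)).hom

/-- The linear map between weight modules defined by a morphism of `C_J`-modules. -/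
noncomputable def mapHom {F G : LinearModuleCat k (PathCat k (integralSet p))} (f : F ⟶ G) :
    Model p (toSystem F) →ₗ[WeylAlgebra k I] Model p (toSystem G) :=
  Model.map (systemHom p f)
    fun U W x => (congr(($(f.hom.naturality (canon k U W))).hom x)).symm

variable {p}

theorem mapHom_of {F G : LinearModuleCat k (PathCat k (integralSet p))} (f : F ⟶ G) (v : I →₀ ℤ)
    (a : (toSystem F).V (chamber p v)) :
    mapHom p f (Model.of p (toSystem F) v a) = Model.of p (toSystem G) v (systemHom p f _ a) :=
  Model.map_of _ _ _ _

theorem mapHom_id (F : LinearModuleCat k (PathCat k (integralSet p))) :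
    mapHom p (𝟙 F) = LinearMap.id :=
  Model.smul_hom_ext fun v a => mapHom_of _ v a

theorem mapHom_comp {F G H : LinearModuleCat k (PathCat k (integralSet p))} (f : F ⟶ G)
    (g : G ⟶ H) : mapHom p (f ≫ g) = mapHom p g ∘ₗ mapHom p f :=
  Model.smul_hom_ext fun v a => by
    rw [LinearMap.comp_apply, mapHom_of, mapHom_of, mapHom_of]
    rfl

theorem mapHom_add {F G : LinearModuleCat k (PathCat k (integralSet p))} (f g : F ⟶ G) :
    mapHom p (f + g) = mapHom p f + mapHom p g :=
  Model.smul_hom_ext fun v a => by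
    rw [LinearMap.add_apply, mapHom_of, mapHom_of, mapHom_of, ← map_add]
    rfl

theorem mapHom_smul {F G : LinearModuleCat k (PathCat k (integralSet p))} (c : k) (f : F ⟶ G)
    (x : Model p (toSystem F)) : mapHom p (c • f) x = c • mapHom p f x := by
  have : (mapHom p (c • f)).restrictScalars k = c • (mapHom p f).restrictScalars k :=
    Model.hom_ext fun v a => by
      rw [LinearMap.smul_apply]
      change mapHom p (c • f) _ = c • mapHom p f _
      rw [mapHom_of, mapHom_of, ← map_smul]
      rfl
  exact DFunLike.congr_fun this x

variable (p)

/-- The functor sending a `C_J`-module to its weight module over the Weyl algebra. -/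
noncomputable def modelFunctor : LinearModuleCat k (PathCat k (integralSet p)) ⥤ Block p where
  obj F := ⟨ModuleCat.of (WeylAlgebra k I) (Model p (toSystem F)),
    blockProperty_of_iSup_eq_top (Model.iSup_latticeWeightSpace p _)⟩
  map f := ObjectProperty.homMk (ModuleCat.ofHom (mapHom p f))
  map_id F := by
    ext1
    exact ModuleCat.hom_ext (mapHom_id F)
  map_comp f g := by
    ext1
    exact ModuleCat.hom_ext (mapHom_comp f g)

instance : (modelFunctor p).Additive where
  map_add {F G f g} := by
    ext1
    exact ModuleCat.hom_ext (mapHom_add f g)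

instance : (modelFunctor p).Linear k where
  map_smul {F G} f c := by
    ext1
    refine ModuleCat.hom_ext (LinearMap.ext fun x => (mapHom_smul c f x).trans ?_)
    exact (algebraMap_smul (WeylAlgebra k I) c (mapHom p f x)).symm

instance : (modelFunctor p).Faithful where
  map_injective {F G f g} h := by
    have h0 : mapHom p f = mapHom p g := congrArg (fun f => f.hom.hom) h
    have h1 := Model.eq_of_map_eq h0
    ext1
    ext X : 2
    exact ModuleCat.hom_ext (congrFun h1 X.as)

instance : (modelFunctor p).Full where
  map_surjective {F G} g := by
    obtain ⟨h, hh, he⟩ := Model.exists_map_eq g.hom.hom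
    refine ⟨homOfSystem h hh, ?_⟩
    ext1
    exact ModuleCat.hom_ext he

end

end Weyl

/-! ### Every weight module in the block comes from a `C_J`-module -/

/-- In a monoid, elements indexed by `i` and an integer which commute for different `i` have
well-defined products along finitely supported integral vectors. -/
theorem exists_lattice_prod {I R : Type*} [Monoid R] (s : I → ℤ → R) (h0 : ∀ i, s i 0 = 1)
    (hs : ∀ i j m n, i ≠ j → Commute (s i m) (s j n)) :
    ∃ T : (I →₀ ℤ) → R, T 0 = 1 ∧ ∀ u i, T u = s i (u i) * T (u.erase i) := by
  classical
  have hc : ∀ u : I →₀ ℤ,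
      (u.support : Set I).Pairwise (Function.onFun Commute fun i => s i (u i)) :=
    fun u i _ j _ hij => hs i j _ _ hij
  refine ⟨fun u => u.support.noncommProd (fun i => s i (u i)) (hc u), ?_, fun u i => ?_⟩
  · exact Finset.noncommProd_empty _ _
  · dsimp only
    by_cases hi : i ∈ u.support
    · rw [← Finset.mul_noncommProd_erase _ hi]
      congr 1
      refine Finset.noncommProd_congr Finsupp.support_erase.symm (fun j hj => ?_) _
      rw [Finsupp.erase_ne (by
        rw [Finsupp.support_erase] at hj
        exact Finset.ne_of_mem_erase hj)]
    · have hu : u i = 0 := Finsupp.notMem_support_iff.1 hi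
      rw [hu, h0, one_mul]
      have : u.erase i = u := Finsupp.erase_of_notMem_support hi
      simp only [this]

namespace Weyl

open SubsetQuiver

section

variable {k I : Type u} [Field k] {p : I → k} {M : Type*} [AddCommGroup M]
  [Module k M] [Module (WeylAlgebra k I) M] [IsScalarTower k (WeylAlgebra k I) M]

theorem exists_linearMap_of_weightSpaces [CharZero k]
    (h : ⨆ v, latticeWeightSpace p M v = ⊤) {N : Type*} [AddCommGroup N] [Module k N]
    (F : ∀ v, latticeWeightSpace p M v →ₗ[k] N) :
    ∃ g : M →ₗ[k] N, ∀ v x (hx : x ∈ latticeWeightSpace p M v), g x = F v ⟨x, hx⟩ := by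
  classical
  let e := LinearEquiv.ofBijective (DirectSum.coeLinearMap (latticeWeightSpace p M))
    (isInternal_latticeWeightSpace h)
  refine ⟨DirectSum.toModule k _ N F ∘ₗ e.symm.toLinearMap, fun v x hx => ?_⟩
  have : e.symm x = DirectSum.lof k _ (fun v => latticeWeightSpace p M v) v ⟨x, hx⟩ := by
    rw [LinearEquiv.symm_apply_eq]
    exact (DirectSum.coeLinearMap_lof (latticeWeightSpace p M) v ⟨x, hx⟩).symm
  rw [LinearMap.comp_apply, LinearEquiv.coe_coe, this, DirectSum.toModule_lof]

theorem linearMap_ext_weightSpaces (h : ⨆ v, latticeWeightSpace p M v = ⊤) {N : Type*}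
    [AddCommGroup N] [Module k N] {f g : M →ₗ[k] N}
    (hfg : ∀ v, ∀ x ∈ latticeWeightSpace p M v, f x = g x) : f = g := by
  refine LinearMap.ext fun x => ?_
  have hx : x ∈ ⨆ v, latticeWeightSpace p M v := h ▸ Submodule.mem_top
  induction hx using Submodule.iSup_induction' with
  | mem v x hx => exact hfg v x hx
  | zero => rw [map_zero, map_zero]
  | add x y _ _ hx hy => rw [map_add, map_add, hx, hy]

variable [CharZero k]

/-- The generators `Y i`, rescaled on each weight space so that they are inverse to the generators
`X i` away from the walls. -/
theorem exists_lowering (h : ⨆ v, latticeWeightSpace p M v = ⊤) (i : I) :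
    ∃ L : Module.End k M, ∀ v, ∀ x ∈ latticeWeightSpace p M v,
      L x = (Model.yFactor p i v)⁻¹ • genY k i • x := by
  obtain ⟨L, hL⟩ := exists_linearMap_of_weightSpaces h fun v =>
    (Model.yFactor p i v)⁻¹ • DistribSMul.toLinearMap k M (genY k i) ∘ₗ
      (latticeWeightSpace p M v).subtype
  exact ⟨L, fun v x hx => hL v x hx⟩

/-- Parallel transport between weight spaces: compositions of the generators `X i` and of the
rescaled generators `Y i` along shortest paths. A further step along a generator continues the
transport, unless it crosses back over a wall, in which case the result is zero. -/
theorem exists_transport (h : ⨆ v, latticeWeightSpace p M v = ⊤) :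
    ∃ T : (I →₀ ℤ) → Module.End k M, T 0 = 1 ∧
      (∀ u v, ∀ x ∈ latticeWeightSpace p M v, T u x ∈ latticeWeightSpace p M (v + u)) ∧
      (∀ u v i, ∀ x ∈ latticeWeightSpace p M v,
        (Disjoint (diff (chamber p v) (chamber p (v + u)))
          (diff (chamber p (v + u)) (chamber p (v + u + Finsupp.single i 1))) →
            genX k i • T u x = T (u + Finsupp.single i 1) x) ∧
        (¬ Disjoint (diff (chamber p v) (chamber p (v + u)))
          (diff (chamber p (v + u)) (chamber p (v + u + Finsupp.single i 1))) →
            genX k i • T u x = 0)) ∧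
      (∀ u v i, ∀ x ∈ latticeWeightSpace p M v,
        (Disjoint (diff (chamber p v) (chamber p (v + u)))
          (diff (chamber p (v + u)) (chamber p (v + u - Finsupp.single i 1))) →
            genY k i • T u x =
              Model.yFactor p i (v + u) • T (u - Finsupp.single i 1) x) ∧
        (¬ Disjoint (diff (chamber p v) (chamber p (v + u)))
          (diff (chamber p (v + u)) (chamber p (v + u - Finsupp.single i 1))) →
            genY k i • T u x = 0)) := by
  have hW := weylRelations_gen (k := k) (I := I)
  choose L hL using exists_lowering h
  have hLmem : ∀ i v, ∀ x ∈ latticeWeightSpace p M v,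
      L i x ∈ latticeWeightSpace p M (v - Finsupp.single i 1) := by
    intro i v x hx
    rw [hL i v x hx]
    exact Submodule.smul_mem _ _ (genY_smul_mem hx i)
  let X : I → Module.End k M := fun i => DistribSMul.toLinearMap k M (genX k i)
  have hX : ∀ i x, X i x = genX k i • x := fun i x => rfl
  have hXX : ∀ i j, Commute (X i) (X j) := by
    intro i j
    refine LinearMap.ext fun x => ?_
    simp only [Module.End.mul_apply, hX]
    rw [← mul_smul, hW.xx, mul_smul]
  have hXL : ∀ i j, i ≠ j → Commute (X i) (L j) := by
    intro i j hij
    refine linearMap_ext_weightSpaces h fun v x hx => ?_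
    simp only [Module.End.mul_apply, hX]
    rw [hL j v x hx, hL j _ _ (genX_smul_mem hx i), smul_algebra_smul_comm, ← mul_smul (genX k i),
      ← hW.yx_ne j i hij.symm, mul_smul]
    congr 2
    refine Model.yFactor_congr ?_
    rw [Finsupp.add_apply, Finsupp.single_eq_of_ne hij.symm, add_zero]
  have hLL : ∀ i j, i ≠ j → Commute (L i) (L j) := by
    intro i j hij
    have key : ∀ {i j : I}, i ≠ j → ∀ v, ∀ x ∈ latticeWeightSpace p M v, L i (L j x) =
        ((Model.yFactor p i v)⁻¹ * (Model.yFactor p j v)⁻¹) • (genY k i * genY k j) • x := by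
      intro i j hij v x hx
      rw [hL j v x hx, map_smul, hL i _ _ (genY_smul_mem hx j), mul_smul, mul_smul, smul_comm]
      congr 2
      refine Model.yFactor_congr ?_
      rw [Finsupp.sub_apply, Finsupp.single_eq_of_ne hij, sub_zero]
    refine linearMap_ext_weightSpaces h fun v x hx => ?_
    simp only [Module.End.mul_apply]
    rw [key hij v x hx, key hij.symm v x hx, hW.yy, mul_comm]
  -- The transport by `n` steps in the direction of `i`.
  let s : I → ℤ → Module.End k M := fun i n => X i ^ n.toNat * L i ^ (-n).toNat
  have hs0 : ∀ i, s i 0 = 1 := fun i => by simp [s]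
  have hsX : ∀ i n, 0 ≤ n → s i (n + 1) = X i * s i n := by
    intro i n hn
    have h1 : (n + 1).toNat = n.toNat + 1 := by omega
    have h2 : (-(n + 1)).toNat = (-n).toNat := by omega
    simp only [s]
    rw [h1, h2, pow_succ', mul_assoc]
  have hsL : ∀ i n, n ≤ 0 → s i (n - 1) = L i * s i n := by
    intro i n hn
    have h1 : (n - 1).toNat = 0 := by omega
    have h2 : (-(n - 1)).toNat = (-n).toNat + 1 := by omega
    have h3 : n.toNat = 0 := by omega
    simp only [s]
    rw [h1, h2, h3, pow_succ', pow_zero, one_mul, one_mul]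
  obtain ⟨T, hT0, hT⟩ := exists_lattice_prod s hs0 (fun i j m n hij =>
    (((hXX i j).pow_pow _ _).mul_right ((hXL i j hij).pow_pow _ _)).mul_left
      (((hXL j i hij.symm).symm.pow_pow _ _).mul_right ((hLL i j hij).pow_pow _ _)))
  have hTX : ∀ u i, 0 ≤ u i → T (u + Finsupp.single i 1) = X i * T u := by
    intro u i hu
    rw [hT u i, hT (u + Finsupp.single i 1) i, Finsupp.add_apply, Finsupp.single_eq_same,
      hsX _ _ hu, mul_assoc, Finsupp.erase_add, Finsupp.erase_single, add_zero]
  have hTL : ∀ u i, u i ≤ 0 → T (u - Finsupp.single i 1) = L i * T u := by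
    intro u i hu
    rw [hT u i, hT (u - Finsupp.single i 1) i, Finsupp.sub_apply, Finsupp.single_eq_same,
      hsL _ _ hu, mul_assoc, Finsupp.erase_sub, Finsupp.erase_single, sub_zero]
  have hmem : ∀ u v, ∀ x ∈ latticeWeightSpace p M v, T u x ∈ latticeWeightSpace p M (v + u) := by
    intro u
    induction u using lattice_induction with
    | zero =>
      intro v x hx
      rwa [hT0, add_zero]
    | add u i hu ih =>
      intro v x hx
      rw [hTX u i hu, ← add_assoc]
      exact genX_smul_mem (ih v x hx) i
    | sub u i hu ih =>
      intro v x hx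
      rw [hTL u i hu, ← add_sub_assoc]
      exact hLmem i _ _ (ih v x hx)
  have hYL : ∀ i v, ∀ x ∈ latticeWeightSpace p M v,
      genY k i • x = Model.yFactor p i v • L i x := by
    intro i v x hx
    rw [hL i v x hx, smul_smul, mul_inv_cancel₀ (Model.yFactor_ne_zero i v), one_smul]
  refine ⟨T, hT0, hmem, fun u v i x hx => ?_, fun u v i x hx => ?_⟩
  · rcases le_or_gt 0 (u i) with hu | hu
    · refine ⟨fun _ => ?_, fun hd => ?_⟩
      · rw [hTX u i hu]
        rfl
      · exact absurd (disjoint_diff_chamber p (Model.between_add v u i hu)) hd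
    · -- A step back: it undoes the last step `L i` of the transport, up to a factor which vanishes
      -- exactly at the wall.
      have hw : v + u + Finsupp.single i 1 = v + (u + Finsupp.single i 1) := add_assoc _ _ _
      have hw' : v + (u + Finsupp.single i 1) - Finsupp.single i 1 = v + u := by
        rw [← hw, add_sub_cancel_right]
      have hy := hmem (u + Finsupp.single i 1) v x hx
      have hTu : T u x = L i (T (u + Finsupp.single i 1) x) := by
        have := hTL (u + Finsupp.single i 1) i (by
          rw [Finsupp.add_apply, Finsupp.single_eq_same]
          omega)
        rw [add_sub_cancel_right] at this
        rw [this]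
        rfl
      have hXT : genX k i • T u x = ((Model.yFactor p i (v + (u + Finsupp.single i 1)))⁻¹ *
          (p i + ((v + (u + Finsupp.single i 1) : I →₀ ℤ) i : k))) •
            T (u + Finsupp.single i 1) x := by
        rw [hTu, hL i _ _ hy, smul_algebra_smul_comm, genX_smul_genY_smul hy, smul_smul]
      by_cases hz : p i + ((v + (u + Finsupp.single i 1) : I →₀ ℤ) i : k) = 0
      · have hnd : ¬ Disjoint (diff (chamber p v) (chamber p (v + u)))
            (diff (chamber p (v + u)) (chamber p (v + u + Finsupp.single i 1))) := by
          have h1 := mem_diff_chamber_sub_single hz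
          rw [hw'] at h1
          rw [hw]
          refine Set.not_disjoint_iff.2 ⟨_, ?_, h1⟩
          rw [mem_diff_chamber]
          have h2 := isNonnegAt_of_eq_zero hz
          rw [hw'] at h2
          have h3 : IsNonnegAt p v i := h2.1.mono (by
            rw [Finsupp.add_apply, Finsupp.add_apply, Finsupp.single_eq_same]
            omega)
          exact fun h4 => h2.2 (h4.1 h3)
        exact ⟨fun hd => absurd hd hnd, fun _ => by rw [hXT, hz, mul_zero, zero_smul]⟩
      · have hch := chamber_sub_single hz
        rw [hw', ← hw] at hch
        refine ⟨fun _ => ?_, fun hd => absurd ?_ hd⟩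
        · rw [hXT, Model.yFactor_of_ne_zero hz, inv_mul_cancel₀ hz, one_smul]
        · rw [hch, diff_self]
          exact Set.disjoint_empty _
  · have hTu := hmem u v x hx
    rcases le_or_gt (u i) 0 with hu | hu
    · refine ⟨fun _ => ?_, fun hd => ?_⟩
      · rw [hTL u i hu, hYL i _ _ hTu]
        rfl
      · exact absurd (disjoint_diff_chamber p (Model.between_sub v u i hu)) hd
    · -- A step back: it undoes the last step `X i` of the transport, up to a factor which vanishes
      -- exactly at the wall.
      have hw : v + u - Finsupp.single i 1 = v + (u - Finsupp.single i 1) := add_sub_assoc _ _ _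
      have hy := hmem (u - Finsupp.single i 1) v x hx
      have hTu' : T u x = genX k i • T (u - Finsupp.single i 1) x := by
        have := hTX (u - Finsupp.single i 1) i (by
          rw [Finsupp.sub_apply, Finsupp.single_eq_same]
          omega)
        rw [sub_add_cancel] at this
        rw [this]
        rfl
      have hYT : genY k i • T u x = (p i + ((v + u) i : k)) • T (u - Finsupp.single i 1) x := by
        rw [hTu', genY_smul_genX_smul hy, ← hw, Finsupp.sub_apply, Finsupp.single_eq_same]
        congr 1
        push_cast
        ring
      by_cases hz : p i + ((v + u) i : k) = 0
      · have hnd : ¬ Disjoint (diff (chamber p v) (chamber p (v + u)))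
            (diff (chamber p (v + u)) (chamber p (v + u - Finsupp.single i 1))) := by
          have h1 := mem_diff_chamber_sub_single hz
          rw [diff_comm] at h1
          refine Set.not_disjoint_iff.2 ⟨_, ?_, h1⟩
          rw [mem_diff_chamber]
          have h2 := isNonnegAt_of_eq_zero hz
          have h3 : ¬ IsNonnegAt p v i := fun h3 => h2.2 (h3.mono (by
            rw [Finsupp.sub_apply, Finsupp.add_apply, Finsupp.single_eq_same]
            omega))
          exact fun h4 => h3 (h4.2 h2.1)
        exact ⟨fun hd => absurd hd hnd, fun _ => by rw [hYT, hz, zero_smul]⟩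
      · refine ⟨fun _ => ?_, fun hd => absurd ?_ hd⟩
        · rw [hYT, Model.yFactor_of_ne_zero hz]
        · rw [chamber_sub_single hz, diff_self]
          exact Set.disjoint_empty _

/-- Transports compose to the transport of the sum, unless the composite path crosses a wall and
then crosses it back. -/
theorem exists_transport_comp (h : ⨆ v, latticeWeightSpace p M v = ⊤) :
    ∃ T : (I →₀ ℤ) → Module.End k M, T 0 = 1 ∧
      (∀ u v, ∀ x ∈ latticeWeightSpace p M v, T u x ∈ latticeWeightSpace p M (v + u)) ∧
      (∀ u v i, ∀ x ∈ latticeWeightSpace p M v, chamber p (v + u) = chamber p v →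
        genX k i • T u x = T (u + Finsupp.single i 1) x) ∧
      (∀ u v i, ∀ x ∈ latticeWeightSpace p M v, chamber p (v + u) = chamber p v →
        genY k i • T u x = Model.yFactor p i (v + u) • T (u - Finsupp.single i 1) x) ∧
      (∀ u' u v, ∀ x ∈ latticeWeightSpace p M v,
        (Disjoint (diff (chamber p v) (chamber p (v + u)))
          (diff (chamber p (v + u)) (chamber p (v + u + u'))) → T u' (T u x) = T (u + u') x) ∧
        (¬ Disjoint (diff (chamber p v) (chamber p (v + u)))
          (diff (chamber p (v + u)) (chamber p (v + u + u'))) → T u' (T u x) = 0)) := by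
  obtain ⟨T, hT0, hmem, hX, hY⟩ := exists_transport h
  -- The possible positions of the sets of walls crossed by three consecutive paths.
  have key : ∀ {U V W Z : Vertex (integralSet p)}, Disjoint (diff V W) (diff W Z) →
      (Disjoint (diff U V) (diff V W) →
        (Disjoint (diff U W) (diff W Z) ↔ Disjoint (diff U V) (diff V Z))) ∧
      (¬ Disjoint (diff U V) (diff V W) → ¬ Disjoint (diff U V) (diff V Z)) := by
    intro U V W Z h1
    have hVZ : diff V Z = diff V W ∪ diff W Z := by
      rw [diff_triangle V W Z, h1.symmDiff_eq_sup]
      rfl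
    refine ⟨fun h2 => ?_, fun h2 => ?_⟩
    · have hUW : diff U W = diff U V ∪ diff V W := by
        rw [diff_triangle U V W, h2.symmDiff_eq_sup]
        rfl
      rw [hUW, hVZ, Set.disjoint_union_left, Set.disjoint_union_right]
      tauto
    · rw [hVZ, Set.disjoint_union_right]
      tauto
  refine ⟨T, hT0, hmem, fun u v i x hx hch => (hX u v i x hx).1 ?_,
    fun u v i x hx hch => (hY u v i x hx).1 ?_, fun u' => ?_⟩
  · rw [hch, diff_self]
    exact Set.empty_disjoint _
  · rw [hch, diff_self]
    exact Set.empty_disjoint _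
  · induction u' using lattice_induction with
    | zero =>
      intro u v x hx
      rw [hT0, add_zero, add_zero, diff_self]
      exact ⟨fun _ => rfl, fun hd => absurd (Set.disjoint_empty _) hd⟩
    | add u' i hu ih =>
      intro u v x hx
      have hd := disjoint_diff_chamber p (Model.between_add (v + u) u' i hu)
      have hstep : T (u' + Finsupp.single i 1) (T u x) = genX k i • T u' (T u x) :=
        ((hX u' (v + u) i _ (hmem u v x hx)).1 hd).symm
      have hk := key (U := chamber p v) hd
      have hih := ih u v x hx
      have hXs := hX (u + u') v i x hx
      rw [← add_assoc v u u'] at hXs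
      rw [hstep, ← add_assoc (v + u), ← add_assoc u]
      by_cases h1 : Disjoint (diff (chamber p v) (chamber p (v + u)))
          (diff (chamber p (v + u)) (chamber p (v + u + u')))
      · rw [hih.1 h1, ← hk.1 h1]
        exact hXs
      · rw [hih.2 h1, smul_zero]
        exact ⟨fun h2 => absurd h2 (hk.2 h1), fun _ => rfl⟩
    | sub u' i hu ih =>
      intro u v x hx
      have hd := disjoint_diff_chamber p (Model.between_sub (v + u) u' i hu)
      have hstep : T (u' - Finsupp.single i 1) (T u x) =
          (Model.yFactor p i (v + u + u'))⁻¹ • genY k i • T u' (T u x) := by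
        rw [(hY u' (v + u) i _ (hmem u v x hx)).1 hd, smul_smul,
          inv_mul_cancel₀ (Model.yFactor_ne_zero _ _), one_smul]
      have hk := key (U := chamber p v) hd
      have hih := ih u v x hx
      have hYs := hY (u + u') v i x hx
      rw [← add_assoc v u u'] at hYs
      rw [hstep, ← add_sub_assoc (v + u), ← add_sub_assoc u]
      by_cases h1 : Disjoint (diff (chamber p v) (chamber p (v + u)))
          (diff (chamber p (v + u)) (chamber p (v + u + u')))
      · rw [hih.1 h1, ← hk.1 h1]
        refine ⟨fun h2 => ?_, fun h2 => ?_⟩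
        · rw [hYs.1 h2, smul_smul, inv_mul_cancel₀ (Model.yFactor_ne_zero _ _), one_smul]
        · rw [hYs.2 h2, smul_zero]
      · rw [hih.2 h1, smul_zero, smul_zero]
        exact ⟨fun h2 => absurd h2 (hk.2 h1), fun _ => rfl⟩

end

end Weyl

namespace Weyl

open SubsetQuiver

section

variable {k I : Type u} [Field k] [CharZero k] {p : I → k}

/-- A module which is the sum of its weight spaces is isomorphic to the weight module of a system:
take the weight spaces at the chosen weights of the chambers, with the transports between them. -/
theorem exists_model_equiv {M : Type u} [AddCommGroup M] [Module k M]
    [Module (WeylAlgebra k I) M] [IsScalarTower k (WeylAlgebra k I) M]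
    (h : ⨆ v, latticeWeightSpace p M v = ⊤) :
    ∃ S : CubeSystem k (integralSet p), Nonempty (Model p S ≃ₗ[WeylAlgebra k I] M) := by
  obtain ⟨T, hT0, hmem, hX, hY, hcomp⟩ := exists_transport_comp h
  -- The transport between two weights.
  let τ : ∀ v w, latticeWeightSpace p M v →ₗ[k] latticeWeightSpace p M w := fun v w =>
    (T (w - v)).restrict fun x hx => by simpa using hmem (w - v) v x hx
  have hτ : ∀ v w x, (τ v w x : M) = T (w - v) x := fun v w x => rfl
  have hτ_self : ∀ v x, τ v v x = x := by
    intro v x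
    ext1
    rw [hτ, sub_self, hT0]
    rfl
  have hτ_comp : ∀ {v w z}, Disjoint (diff (chamber p v) (chamber p w))
      (diff (chamber p w) (chamber p z)) → ∀ x, τ w z (τ v w x) = τ v z x := by
    intro v w z hd x
    ext1
    have := (hcomp (z - w) (w - v) v x x.2).1
    rw [add_sub_cancel, add_sub_cancel] at this
    rw [hτ, hτ, hτ, this hd]
    congr 2
    abel
  have hτ_zero : ∀ {v w z}, ¬ Disjoint (diff (chamber p v) (chamber p w))
      (diff (chamber p w) (chamber p z)) → ∀ x, τ w z (τ v w x) = 0 := by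
    intro v w z hd x
    ext1
    have := (hcomp (z - w) (w - v) v x x.2).2
    rw [add_sub_cancel, add_sub_cancel] at this
    rw [hτ, hτ, this hd]
    rfl
  have hU := fun U => chamber_chamberPoint p U
  let S : CubeSystem k (integralSet p) :=
    { V := fun U => latticeWeightSpace p M (chamberPoint p U)
      φ := fun U W => τ _ _
      φ_self := fun U x => hτ_self _ x
      φ_comp := fun {U W Z} hd x => hτ_comp (by rwa [hU, hU, hU]) x
      φ_zero := fun {U W Z} hd x => hτ_zero (by rwa [hU, hU, hU]) x }
  let f : ∀ v, S.V (chamber p v) →ₗ[k] M := fun v =>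
    (latticeWeightSpace p M v).subtype ∘ₗ τ (chamberPoint p (chamber p v)) v
  have hf : ∀ v w a, f w (S.φ (chamber p v) (chamber p w) a) =
      τ (chamberPoint p (chamber p v)) w a := by
    intro v w a
    exact congrArg Subtype.val (hτ_comp (disjoint_diff_of_eq_right (hU _) _) a)
  have hch : ∀ v, chamber p (chamberPoint p (chamber p v) + (v - chamberPoint p (chamber p v))) =
      chamber p (chamberPoint p (chamber p v)) := by
    intro v
    rw [add_sub_cancel, hU]
  let F : Model p S →ₗ[WeylAlgebra k I] M := Model.descOfGen f
    (fun i v a => by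
      rw [hf, hτ]
      refine Eq.trans ?_ (hX _ _ i a a.2 (hch v)).symm
      rw [sub_add_eq_add_sub])
    (fun i v a => by
      rw [hf, hτ]
      refine Eq.trans ?_ (hY _ _ i a a.2 (hch v)).symm
      rw [add_sub_cancel, sub_right_comm])
  have hF : ∀ v a, F (Model.of p S v a) = τ (chamberPoint p (chamber p v)) v a := fun v a =>
    Model.descOfGen_of _ _ _ v a
  obtain ⟨G, hG⟩ := exists_linearMap_of_weightSpaces h fun v =>
    (Model.of p S v ∘ₗ (τ v (chamberPoint p (chamber p v)) :
      latticeWeightSpace p M v →ₗ[k] S.V (chamber p v)))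
  have hGF : G ∘ₗ F.restrictScalars k = LinearMap.id := by
    refine Model.hom_ext fun v a => ?_
    change G (F (Model.of p S v a)) = _
    rw [hF, hG _ _ (Subtype.property _)]
    refine congrArg (Model.of p S v) ?_
    exact (hτ_comp (disjoint_diff_of_eq_left (hU _) _) a).trans (hτ_self _ a)
  have hFG : F.restrictScalars k ∘ₗ G = LinearMap.id := by
    refine linearMap_ext_weightSpaces h fun v x hx => ?_
    change F (G x) = _
    rw [hG v x hx]
    refine (hF v _).trans ?_
    exact congrArg Subtype.val
      ((hτ_comp (disjoint_diff_of_eq_left (hU _).symm _) _).trans (hτ_self v ⟨x, hx⟩))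
  exact ⟨S, ⟨LinearEquiv.ofBijective F ⟨Function.LeftInverse.injective (g := G) fun x =>
    DFunLike.congr_fun hGF x, Function.RightInverse.surjective (g := G) fun x =>
    DFunLike.congr_fun hFG x⟩⟩⟩

/-- A system and the system of its `C_J`-module have isomorphic weight modules. -/
noncomputable def Model.toModuleEquiv (S : CubeSystem k (integralSet p)) :
    Model p (toSystem S.toModule) ≃ₗ[WeylAlgebra k I] Model p S :=
  -- The spaces of the two systems agree by definition only, so the identities need explicit types.
  let h₁ : ∀ U, (toSystem S.toModule).V U →ₗ[k] S.V U := fun U =>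
    (LinearMap.id : S.V U →ₗ[k] S.V U)
  let h₂ : ∀ U, S.V U →ₗ[k] (toSystem S.toModule).V U := fun U =>
    (LinearMap.id : S.V U →ₗ[k] S.V U)
  have c₁ : ∀ U W x, S.φ U W (h₁ U x) = h₁ W ((toSystem S.toModule).φ U W x) := fun U W x =>
    (S.toSystem_toModule_φ U W x).symm
  have c₂ : ∀ U W x, (toSystem S.toModule).φ U W (h₂ U x) = h₂ W (S.φ U W x) := fun U W x =>
    S.toSystem_toModule_φ U W x
  LinearEquiv.ofLinearMap (Model.map h₁ c₁) (Model.map h₂ c₂)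
    (Model.smul_hom_ext fun v a =>
      (congrArg (Model.map h₁ c₁) (Model.map_of h₂ c₂ v a)).trans (Model.map_of h₁ c₁ v _))
    (Model.smul_hom_ext fun v a =>
      (congrArg (Model.map h₂ c₂) (Model.map_of h₁ c₁ v a)).trans (Model.map_of h₂ c₂ v _))

open scoped ModuleCat in
theorem modelFunctor_essSurj [IsAlgClosed k] [Infinite I] (hI : Cardinal.mk I < Cardinal.mk k)
    (p : I → k) : (modelFunctor p).EssSurj where
  mem_essImage M := by
    obtain ⟨S, ⟨e⟩⟩ := exists_model_equiv (iSup_latticeWeightSpace_eq_top hI M.property)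
    let e' : Model p (toSystem S.toModule) ≃ₗ[WeylAlgebra k I] M.obj :=
      (Model.toModuleEquiv S).trans e
    exact ⟨S.toModule, ⟨(blockProperty p).isoMk e'.toModuleIso⟩⟩

theorem modelFunctor_isEquivalence [IsAlgClosed k] [Infinite I]
    (hI : Cardinal.mk I < Cardinal.mk k) (p : I → k) : (modelFunctor p).IsEquivalence where
  essSurj := modelFunctor_essSurj hI p

/-- The block of `p` is equivalent to the category of `C_J`-modules. -/
theorem exists_block_equivalence [IsAlgClosed k] [Infinite I]
    (hI : Cardinal.mk I < Cardinal.mk k) (p : I → k) :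
    ∃ e : Block p ≌ LinearModuleCat k (PathCat k (integralSet p)),
      e.functor.Additive ∧ e.functor.Linear k := by
  have := modelFunctor_isEquivalence hI p
  let e := (modelFunctor p).asEquivalence
  have : e.functor.Additive := inferInstanceAs (modelFunctor p).Additive
  have : e.functor.Linear k := inferInstanceAs ((modelFunctor p).Linear k)
  exact ⟨e.symm, e.inverse_additive, e.inverseLinear k⟩

end

end Weyl

/-! ### The case without walls -/

namespace SubsetQuiver

variable {k E : Type u} [Field k]

theorem vertex_eq_of_isEmpty [IsEmpty E] (U W : Vertex E) : U = W :=
  eq_of_diff_eq_empty (Set.eq_empty_of_isEmpty _)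

variable (E) in
/-- The empty subset, as a vertex of `Q_E`. -/
def emptyVertex : Vertex E := ⟨∅⟩

variable (k E) in
/-- Evaluation of `C_E`-modules at the empty subset. -/
noncomputable def evaluation : LinearModuleCat k (PathCat k E) ⥤ ModuleCat.{u} k where
  obj F := F.obj.obj (vtx k (emptyVertex E))
  map f := f.hom.app (vtx k (emptyVertex E))

instance : (evaluation k E).Additive where
  map_add := rfl

instance : (evaluation k E).Linear k where
  map_smul _ _ := rfl

instance [IsEmpty E] : (evaluation k E).Faithful where
  map_injective {F G f g} h := by
    ext1
    ext X : 2
    obtain ⟨U⟩ := X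
    obtain rfl : U = emptyVertex E := vertex_eq_of_isEmpty U (emptyVertex E)
    exact h

instance [IsEmpty E] : (evaluation k E).Full where
  map_surjective {F G} g := by
    have hd : ∀ U V W : Vertex E, Disjoint (diff U V) (diff V W) := fun U V W => by
      rw [Set.eq_empty_of_isEmpty (diff U V)]
      exact Set.empty_disjoint _
    let F' := toSystem F
    let G' := toSystem G
    let g' : F'.V (emptyVertex E) →ₗ[k] G'.V (emptyVertex E) := g.hom
    refine ⟨homOfSystem (fun U => G'.φ (emptyVertex E) U ∘ₗ g' ∘ₗ F'.φ U (emptyVertex E))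
      fun U W x => ?_, ?_⟩
    · change G'.φ U W (G'.φ _ U (g' (F'.φ U _ x))) = G'.φ _ W (g' (F'.φ W _ (F'.φ U W x)))
      rw [G'.φ_comp (hd _ _ _), F'.φ_comp (hd _ _ _)]
    · refine ModuleCat.hom_ext (LinearMap.ext fun x => ?_)
      exact (G'.φ_self _ _).trans (congrArg g' (F'.φ_self _ x))

instance [IsEmpty E] : (evaluation k E).EssSurj where
  mem_essImage V := by
    have hd : ∀ U V W : Vertex E, Disjoint (diff U V) (diff V W) := fun U V W => by
      rw [Set.eq_empty_of_isEmpty (diff U V)]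
      exact Set.empty_disjoint _
    let S : CubeSystem k E :=
      { V := fun _ => V
        φ := fun _ _ => LinearMap.id
        φ_self := fun _ _ => rfl
        φ_comp := fun _ _ => rfl
        φ_zero := fun h _ => absurd (hd _ _ _) h }
    exact ⟨S.toModule, ⟨Iso.refl V⟩⟩

instance [IsEmpty E] : (evaluation k E).IsEquivalence where

end SubsetQuiver

namespace Weyl

section

variable {k I : Type u} [Field k] [CharZero k] {p : I → k}

open scoped ModuleCat in
/-- The block is closed under submodules. -/
theorem blockProperty_submodule [IsAlgClosed k] [Infinite I]
    (hI : Cardinal.mk I < Cardinal.mk k) {M : ModuleCat.{u} (WeylAlgebra k I)}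
    (hM : blockProperty p M) (N : Submodule (WeylAlgebra k I) M) :
    blockProperty p (ModuleCat.of (WeylAlgebra k I) N) := by
  have htop := iSup_latticeWeightSpace_eq_top hI hM
  refine blockProperty_of_iSup_eq_top (k := k) (M := N) ?_
  rw [eq_top_iff]
  rintro ⟨x, hxN⟩ -
  have hx : x ∈ ⨆ v, latticeWeightSpace p M v := htop ▸ Submodule.mem_top
  obtain ⟨f, hf, hfx⟩ := (Submodule.mem_iSup_iff_exists_finsupp _ _).1 hx
  have hmem := mem_of_sum_mem (M := M) _ (latticeWeight_injective p) (N.restrictScalars k)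
    (fun i x hx => N.smul_mem _ hx) f.support f (fun v _ => hf v) (by
      change ∑ v ∈ f.support, f v ∈ N
      rw [show ∑ v ∈ f.support, f v = x from hfx]
      exact hxN)
  have hsum : (⟨x, hxN⟩ : N) = ∑ v ∈ f.support.attach, ⟨f v, hmem v v.2⟩ := by
    refine Subtype.ext ?_
    rw [AddSubmonoidClass.coe_finsetSum]
    exact hfx.symm.trans (Finset.sum_attach f.support f).symm
  rw [hsum]
  refine Submodule.sum_mem _ fun v _ => Submodule.mem_iSup_of_mem v.1 fun i => Subtype.ext ?_
  exact hf v i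

/-- If a block is equivalent to the category of vector spaces, then its objects are semisimple:
the inclusion of a submodule is a monomorphism of the block, and monomorphisms of vector spaces
split. -/
theorem isSemisimpleModule_of_equivalence [IsAlgClosed k] [Infinite I]
    (hI : Cardinal.mk I < Cardinal.mk k) (e : Block p ≌ ModuleCat.{u} k) (M : Block p) :
    IsSemisimpleModule (WeylAlgebra k I) M.obj := by
  refine { exists_isCompl := fun N => ?_ }
  let N' : Block p := ⟨ModuleCat.of (WeylAlgebra k I) N, blockProperty_submodule hI M.property N⟩
  let i : N' ⟶ M := ObjectProperty.homMk (ModuleCat.ofHom N.subtype)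
  have hi : Mono i := by
    have : Mono ((blockProperty p).ι.map i) := by
      rw [ModuleCat.mono_iff_injective]
      exact Subtype.val_injective
    exact (blockProperty p).ι.mono_of_mono_map this
  have hmono : Mono (e.functor.map i) := inferInstance
  rw [ModuleCat.mono_iff_injective] at hmono
  obtain ⟨r, hr⟩ := LinearMap.exists_leftInverse_of_injective (e.functor.map i).hom
    (LinearMap.ker_eq_bot.2 hmono)
  obtain ⟨r', hr'⟩ := e.functor.map_surjective (ModuleCat.ofHom r)
  have h1 : i ≫ r' = 𝟙 _ := by
    apply e.functor.map_injective
    rw [Functor.map_comp, hr', CategoryTheory.Functor.map_id]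
    exact ModuleCat.hom_ext hr
  refine ⟨LinearMap.ker r'.hom.hom, LinearMap.isCompl_of_proj fun x => ?_⟩
  exact congr(($h1).hom.hom x)

end

end Weyl

theorem theorem27 {k I : Type u} [Field k] [IsAlgClosed k] [CharZero k] [Infinite I]
    (hI : Cardinal.mk I < Cardinal.mk k) (p : I → k) :
    ((Weyl.integralSet p).Nonempty →
      ∃ e : Weyl.Block p ≌ LinearModuleCat k (SubsetQuiver.PathCat k (Weyl.integralSet p)),
        e.functor.Additive ∧ e.functor.Linear k) ∧
    (Weyl.integralSet p = ∅ →
      (∀ M : Weyl.Block p, IsSemisimpleModule (Weyl.WeylAlgebra k I) M.obj) ∧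
      ∃ e : Weyl.Block p ≌ ModuleCat.{u} k, e.functor.Additive ∧ e.functor.Linear k) := by
  obtain ⟨e, he, he'⟩ := Weyl.exists_block_equivalence hI p
  refine ⟨fun _ => ⟨e, he, he'⟩, fun hJ => ?_⟩
  have : IsEmpty (Weyl.integralSet p) := Set.isEmpty_coe_sort.2 hJ
  let e' := e.trans (SubsetQuiver.evaluation k (Weyl.integralSet p)).asEquivalence
  refine ⟨Weyl.isSemisimpleModule_of_equivalence hI e', e', ?_, ?_⟩
  · exact inferInstanceAs (e.functor ⋙ SubsetQuiver.evaluation k _).Additive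
  · exact inferInstanceAs ((e.functor ⋙ SubsetQuiver.evaluation k _).Linear k)
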